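/- Let $n\ge 2$ and let $L:\mathbb{R}^n\to\mathbb{R}$, $L(s)=\frac{1}{n(n-1)}\sum_{i=1}^n\sum_{j\ne i}|s_i-s_j|$ be the Wilcoxon rank loss (clustered lasso regularizer). Let $\mathrm{Prox}_L(s)$ be the minimizer of $y\mapsto L(y)+\frac12\|y-s\|_2^2$, let $\Delta\in\mathbb{R}^{(n-1)\times n}$ be given by $(\Delta s)_i=s_i-s_{i+1}$, let $\mathcal D=\{s\in\mathbb{R}^n\mid\Delta s\ge0\}$ with Euclidean projection $\Pi_{\mathcal D}$, and let $\varrho\in\mathbb{R}^n$, $\varrho_k=\frac{2n-4k+2}{n(n-1)}$. For a locally Lipschitz map $F$, let $\partial_BF(x)$ be the set of all limits of Jacobians $F'(x_k)$ with $x_k\to x$ and $F$ differentiable at $x_k$ (Bouligand subdifferential), and $\partial F(x)=\mathrm{conv}\,\partial_BF(x)$ the Clarke generalized Jacobian. Let $s\in\mathbb{R}^n$ and let $P_s$ be any permutation matrix such that $P_ss$ is the nonincreasing rearrangement of $s$. (i) The minimizer $\mathrm{Prox}_L(s)$ and the nearest point $\Pi_{\mathcal D}(z)$ ($z\in\mathbb{R}^n$)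 exist and are unique, $\mathrm{Prox}_L(s)=P_s^\top\Pi_{\mathcal D}(P_ss-\varrho)$, and $\Pi_{\mathcal D}$ is computed by the pool-adjacent-violators algorithm. (ii) For $z\in\mathbb{R}^n$ put $\mathcal I_{\mathcal D}(z)=\{i\in[n-1]\mid(\Delta\Pi_{\mathcal D}(z))_i=0\}$, $\mathcal M_{\mathcal D}(z)=\{\lambda\in\mathbb{R}^{n-1}_-\mid\Delta^\top\lambda=z-\Pi_{\mathcal D}(z),\ \lambda_i=0\text{ for }i\notin\mathcal I_{\mathcal D}(z)\}$, and $\mathcal K_{\mathcal D}(z)=\{K\subseteq[n-1]\mid\exists\lambda\in\mathcal M_{\mathcal D}(z):\ \mathrm{supp}(\lambda)\subseteq K\subseteq\mathcal I_{\mathcal D}(z)\}$. For $K\subseteq[n-1]$ let $\Delta_K$ consist of the rows of $\Delta$ indexed by $K$; then $\Delta_K\Delta_K^\top$ is invertible. With $$\mathcal S(s)=\left\{I_n-P_s^\top\Delta_K^\top(\Delta_K\Delta_K^\top)^{-1}\Delta_KP_s\ \middle|\ K\in\mathcal K_{\mathcal D}(P_ss-\varrho)\right\}$$ one has $\partial_B\mathrm{Prox}_L(s)=\mathcal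 S(s)$ and $\partial\,\mathrm{Prox}_L(s)=\mathrm{conv}\,\mathcal S(s)$. (iii) $\mathrm{Prox}_L$ is strongly semismooth with respect to $\partial\,\mathrm{Prox}_L$, and also with respect to $\partial_B\mathrm{Prox}_L$. Here $F$ is strongly semismooth with respect to a set-valued map $\mathcal K$ if $F$ is locally Lipschitz and directionally differentiable, $\mathcal K$ is upper semicontinuous with nonempty compact values, and at every $x$, $F(x+h)-F(x)-Vh=O(\|h\|^2)$ uniformly over $V\in\mathcal K(x+h)$ as $h\to0$. (iv) Let $\theta\in\{0,1\}^{n-1}$ be the indicator vector of $\mathcal I_{\mathcal D}(P_ss-\varrho)$. It has a decomposition $\theta=(\theta^{(1)};\dots;\theta^{(N)})$ into nonempty blocks $\theta^{(i)}\in\{0_{n_i},1_{n_i}\}$, adjacent blocks taking different values. For every such decomposition let $\mathcal J^s=\{i\in[N]\mid\theta^{(i)}=1_{n_i}\}$, with elements $\mathcal J^s_1<\mathcal J^s_2<\cdots$. Define $\theta_s=(\theta_s^{(1)};\dots;\theta_s^{(N)})$ by $\theta_s^{(i)}=0_{n_i+1}$ if $i\in\mathcal J^s$; $\theta_s^{(i)}=1_{n_i+1}$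 if $i\notin\mathcal J^s$ and $N=1$; $\theta_s^{(i)}=1_{n_i}$ if $i\in\{1,N\}\setminus\mathcal J^s$ and $N\ge2$; and $\theta_s^{(i)}=1_{n_i-1}$ otherwise. Define $\Gamma_s\in\mathbb{R}^{n\times|\mathcal J^s|}$ by $$(\Gamma_s)_{\ell,j}=\frac{1}{\sqrt{n_{\mathcal J^s_j}+1}}\ \text{ if }\ \sum_{t<\mathcal J^s_j}n_t+1\le\ell\le\sum_{t\le\mathcal J^s_j}n_t+1,\qquad(\Gamma_s)_{\ell,j}=0\ \text{ otherwise.}$$ Then $\theta_s\in\mathbb{R}^n$, and $\Lambda(s)=\mathrm{Diag}(P_s^\top\theta_s)+P_s^\top\Gamma_s\Gamma_s^\top P_s$ belongs to $\mathcal S(s)$, hence to $\partial\,\mathrm{Prox}_L(s)$. -/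

import Mathlib

open Filter Topology
open scoped Matrix

noncomputable section

namespace RankLoss

/-! ### Proximal mappings and projections -/

/-- `p` minimizes `y ↦ f y + ‖y - x‖² / 2` over the whole space. -/
def IsProxPoint {n : ℕ} (f : EuclideanSpace ℝ (Fin n) → ℝ) (x p : EuclideanSpace ℝ (Fin n)) :
    Prop :=
  IsMinOn (fun y => f y + (1 / 2) * ‖y - x‖ ^ 2) Set.univ p

/-- The proximal mapping of `f`: a minimizer of `y ↦ f y + ‖y - x‖² / 2`
(an arbitrary point if there is none). -/
def prox {n : ℕ} (f : EuclideanSpace ℝ (Fin n) → ℝ) (x : EuclideanSpace ℝ (Fin n)) :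
    EuclideanSpace ℝ (Fin n) :=
  Classical.epsilon (IsProxPoint f x)

/-- `p` is a point of `C` at minimal Euclidean distance from `z`. -/
def IsNearestPoint {n : ℕ} (C : Set (EuclideanSpace ℝ (Fin n)))
    (z p : EuclideanSpace ℝ (Fin n)) : Prop :=
  p ∈ C ∧ ∀ y ∈ C, ‖z - p‖ ≤ ‖z - y‖

/-- The projection onto `C`: a nearest point of `C` (an arbitrary point if there is none). -/
def proj {n : ℕ} (C : Set (EuclideanSpace ℝ (Fin n))) (z : EuclideanSpace ℝ (Fin n)) :
    EuclideanSpace ℝ (Fin n) :=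
  Classical.epsilon (IsNearestPoint C z)

/-! ### Generalized Jacobians and strong semismoothness -/

/-- The matrix of the Fréchet derivative of `F` at `x` in the standard bases. -/
def jacobian {n m : ℕ} (F : EuclideanSpace ℝ (Fin n) → EuclideanSpace ℝ (Fin m))
    (x : EuclideanSpace ℝ (Fin n)) : Matrix (Fin m) (Fin n) ℝ :=
  Matrix.of fun i j => fderiv ℝ F x (EuclideanSpace.single j 1) i

/-- The Bouligand subdifferential of `F` at `x`: all limits of Jacobians of `F` along sequences
of points of differentiability that converge to `x`. -/
def bouligand {n m : ℕ} (F : EuclideanSpace ℝ (Fin n) → EuclideanSpace ℝ (Fin m))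
    (x : EuclideanSpace ℝ (Fin n)) : Set (Matrix (Fin m) (Fin n) ℝ) :=
  {V | ∃ u : ℕ → EuclideanSpace ℝ (Fin n),
    (∀ k, DifferentiableAt ℝ F (u k)) ∧ Tendsto u atTop (𝓝 x) ∧
      Tendsto (fun k => jacobian F (u k)) atTop (𝓝 V)}

/-- The Clarke generalized Jacobian of `F` at `x`: the convex hull of the Bouligand
subdifferential. -/
def clarke {n m : ℕ} (F : EuclideanSpace ℝ (Fin n) → EuclideanSpace ℝ (Fin m))
    (x : EuclideanSpace ℝ (Fin n)) : Set (Matrix (Fin m) (Fin n) ℝ) :=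
  convexHull ℝ (bouligand F x)

/-- `F` is strongly semismooth (everywhere) with respect to the set-valued map `K`:
`F` is locally Lipschitz, `K` is nonempty-valued, compact-valued and upper semicontinuous, `F` is
directionally differentiable, and `F (x + h) - F x - V h = O(‖h‖²)` uniformly in
`V ∈ K (x + h)` as `h → 0`. -/
structure IsStronglySemismooth {n m : ℕ}
    (F : EuclideanSpace ℝ (Fin n) → EuclideanSpace ℝ (Fin m))
    (K : EuclideanSpace ℝ (Fin n) → Set (Matrix (Fin m) (Fin n) ℝ)) : Prop where
  locallyLipschitz : LocallyLipschitz F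
  nonempty : ∀ x, (K x).Nonempty
  compact : ∀ x, IsCompact (K x)
  upperSemicontinuous : ∀ x, UpperHemicontinuousAt K x
  directionallyDifferentiable : ∀ x d, ∃ l,
    Tendsto (fun t : ℝ => t⁻¹ • (F (x + t • d) - F x)) (𝓝[>] 0) (𝓝 l)
  quadratic_estimate : ∀ x, ∃ C : ℝ, ∀ᶠ h in 𝓝 (0 : EuclideanSpace ℝ (Fin n)),
    ∀ V ∈ K (x + h), ‖F (x + h) - F x - V.toEuclideanLin h‖ ≤ C * ‖h‖ ^ 2

/-! ### The rank loss, sorting, and the monotone cone -/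

/-- The Wilcoxon rank loss `(1 / (n (n - 1))) ∑ i, ∑ j ≠ i, |s i - s j|`. -/
def rankLoss (n : ℕ) (s : EuclideanSpace ℝ (Fin n)) : ℝ :=
  1 / ((n : ℝ) * ((n : ℝ) - 1)) * ∑ i, ∑ j ∈ Finset.univ.erase i, |s i - s j|

/-- `σ` sorts `s` in nonincreasing order. The permutation matrix `P = σ.permMatrix ℝ` satisfies
`(P s) k = s (σ k)`, so that `P s` is the nonincreasing rearrangement of `s`. -/
def Sorts {n : ℕ} (σ : Equiv.Perm (Fin n)) (s : EuclideanSpace ℝ (Fin n)) : Prop :=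
  Antitone fun k => s (σ k)

/-- The vector `ϱ` with `ϱ_k = (2 n - 4 k + 2) / (n (n - 1))` for `k = 1, …, n`
(here `k` is shifted, since `Fin n` starts at `0`). -/
def rho (n : ℕ) : EuclideanSpace ℝ (Fin n) :=
  WithLp.toLp 2 fun k =>
    (2 * (n : ℝ) - 4 * ((k : ℕ) + 1 : ℝ) + 2) / ((n : ℝ) * ((n : ℝ) - 1))

/-- The sorted and shifted point `P s - ϱ`. -/
def sortedShift {n : ℕ} (σ : Equiv.Perm (Fin n)) (s : EuclideanSpace ℝ (Fin n)) :
    EuclideanSpace ℝ (Fin n) :=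
  (σ.permMatrix ℝ).toEuclideanLin s - rho n

/-- The difference matrix: `(Δ s)_i = s_i - s_{i+1}`. -/
def diffMat (n : ℕ) : Matrix (Fin (n - 1)) (Fin n) ℝ :=
  Matrix.of fun i j =>
    if (j : ℕ) = (i : ℕ) then 1 else if (j : ℕ) = (i : ℕ) + 1 then -1 else 0

/-- The cone `D = {s | Δ s ≥ 0}` of nonincreasing vectors. -/
def monoCone (n : ℕ) : Set (EuclideanSpace ℝ (Fin n)) :=
  {s | ∀ i, 0 ≤ (diffMat n).toEuclideanLin s i}

/-! ### The pool-adjacent-violators algorithm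

A block is a pair `(total, size)`; its value is the average `total / size`. The blocks built so
far are kept in a stack whose head is the last block. -/

/-- Put a block on the stack; as long as its average exceeds the average of the preceding block
(a violation of the nonincreasing order), pool it with that block. -/
def pavPush : List (ℝ × ℕ) → ℝ × ℕ → List (ℝ × ℕ)
  | [], b => [b]
  | c :: st, b =>
    open Classical in
    if c.1 / c.2 < b.1 / b.2 then pavPush st (c.1 + b.1, c.2 + b.2) else b :: c :: st

/-- The pool-adjacent-violators algorithm for nonincreasing isotonic regression: process the
entries from left to right as blocks of size one, then write out the block averages. -/
def pav (l : List ℝ) : List ℝ :=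
  ((l.foldl (fun st a => pavPush st (a, 1)) []).reverse).flatMap
    fun b => List.replicate b.2 (b.1 / b.2)

/-! ### Active sets, multipliers, and the explicit generalized Jacobian -/

/-- The active set `I_D(z)`. -/
def activeSet {n : ℕ} (z : EuclideanSpace ℝ (Fin n)) : Set (Fin (n - 1)) :=
  {i | (diffMat n).toEuclideanLin (proj (monoCone n) z) i = 0}

/-- The multiplier set `M_D(z)`. -/
def multipliers {n : ℕ} (z : EuclideanSpace ℝ (Fin n)) : Set (EuclideanSpace ℝ (Fin (n - 1))) :=
  {μ | (∀ i, μ i ≤ 0) ∧ (diffMat n)ᵀ.toEuclideanLin μ = z - proj (monoCone n) z ∧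
    ∀ i, i ∉ activeSet z → μ i = 0}

/-- The collection `K_D(z)` of index sets `K` with `supp μ ⊆ K ⊆ I_D(z)` for a multiplier `μ`. -/
def indexSets {n : ℕ} (z : EuclideanSpace ℝ (Fin n)) : Set (Finset (Fin (n - 1))) :=
  {K | ∃ μ ∈ multipliers z, Function.support (fun i => μ i) ⊆ (K : Set (Fin (n - 1))) ∧
    (K : Set (Fin (n - 1))) ⊆ activeSet z}

/-- The submatrix `Δ_K` of the rows of `Δ` indexed by `K`. -/
def diffRows {n : ℕ} (K : Finset (Fin (n - 1))) : Matrix K (Fin n) ℝ :=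
  (diffMat n).submatrix (fun i : K => (i : Fin (n - 1))) id

/-- The matrix `I - Pᵀ Δ_Kᵀ (Δ_K Δ_Kᵀ)⁻¹ Δ_K P`. -/
def jacobianElement {n : ℕ} (σ : Equiv.Perm (Fin n)) (K : Finset (Fin (n - 1))) :
    Matrix (Fin n) (Fin n) ℝ :=
  1 - (σ.permMatrix ℝ)ᵀ * (diffRows K)ᵀ * (diffRows K * (diffRows K)ᵀ)⁻¹ * diffRows K *
    σ.permMatrix ℝ

/-- The set of all `I - Pᵀ Δ_Kᵀ (Δ_K Δ_Kᵀ)⁻¹ Δ_K P` with `K ∈ K_D(P s - ϱ)`. -/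
def jacobianSet {n : ℕ} (σ : Equiv.Perm (Fin n)) (s : EuclideanSpace ℝ (Fin n)) :
    Set (Matrix (Fin n) (Fin n) ℝ) :=
  {Λ | ∃ K ∈ indexSets (sortedShift σ s), Λ = jacobianElement σ K}

/-! ### The distinguished element -/

/-- The indicator vector `θ` of the active set. -/
def activeIndicator {n : ℕ} (z : EuclideanSpace ℝ (Fin n)) : Fin (n - 1) → ℝ :=
  (activeSet z).indicator 1

/-- `θ` is the concatenation of `N` nonempty constant blocks of lengths `len t`, equal to `1` for
`t ∈ J` and to `0` for `t ∉ J`, and adjacent blocks take different values. -/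
structure IsBlockDecomposition {m N : ℕ} (θ : Fin m → ℝ) (len : Fin N → ℕ)
    (J : Finset (Fin N)) : Prop where
  len_pos : ∀ t, 0 < len t
  concat : List.ofFn θ =
    (List.ofFn fun t => List.replicate (len t) (if t ∈ J then (1 : ℝ) else 0)).flatten
  alternate : ∀ t u : Fin N, (u : ℕ) = (t : ℕ) + 1 → (t ∈ J ↔ u ∉ J)

/-- The block `θ_s^{(t)}`: `len t + 1` zeros if `t ∈ J`; otherwise ones, namely `len t - 1` of them
for an inner block, `len t` for a first or last block, and `len t + 1` for the only block. -/
def thetaBlock {N : ℕ} (len : Fin N → ℕ) (J : Finset (Fin N)) (t : Fin N) : List ℝ :=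
  if t ∈ J then List.replicate (len t + 1) 0
  else if N = 1 then List.replicate (len t + 1) 1
  else if (t : ℕ) = 0 ∨ (t : ℕ) + 1 = N then List.replicate (len t) 1
  else List.replicate (len t - 1) 1

/-- The concatenation of the blocks `θ_s^{(1)}, …, θ_s^{(N)}`. -/
def thetaList {N : ℕ} (len : Fin N → ℕ) (J : Finset (Fin N)) : List ℝ :=
  (List.ofFn fun t => thetaBlock len J t).flatten

/-- The matrix `Γ_s`. Its column for the `j`-th element `t` of `J` is the constant
`1 / √(n_t + 1)` on the rows `∑_{u<t} n_u + 1, …, ∑_{u≤t} n_u + 1` (counted from `1`), and `0`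
elsewhere. -/
def gammaMat (n : ℕ) {N : ℕ} (len : Fin N → ℕ) (J : Finset (Fin N)) :
    Matrix (Fin n) (Fin J.card) ℝ :=
  Matrix.of fun l j =>
    if ∑ u ∈ Finset.Iio (J.orderEmbOfFin rfl j), len u ≤ (l : ℕ) ∧
        (l : ℕ) ≤ ∑ u ∈ Finset.Iic (J.orderEmbOfFin rfl j), len u then
      1 / √((len (J.orderEmbOfFin rfl j) : ℝ) + 1)
    else 0

/-- The matrix `Diag(Pᵀ θ_s) + Pᵀ Γ_s Γ_sᵀ P`. -/
def lambdaMat {n N : ℕ} (σ : Equiv.Perm (Fin n)) (θs : Fin n → ℝ) (len : Fin N → ℕ)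
    (J : Finset (Fin N)) : Matrix (Fin n) (Fin n) ℝ :=
  Matrix.diagonal ((σ.permMatrix ℝ)ᵀ *ᵥ θs) +
    (σ.permMatrix ℝ)ᵀ * gammaMat n len J * (gammaMat n len J)ᵀ * σ.permMatrix ℝ

end RankLoss

end

noncomputable section

namespace RankLoss

/-! ### The difference operator -/

/-! On nonincreasing vectors the rank loss is the linear form with gradient `rho n`, and by the
rearrangement inequality sorting a competitor brings it no farther from the sorted `s` while leaving
the loss unchanged. Completing the square then turns the proximal problem into projecting `P s - rho
n` onto the monotone cone (`Sorts.isProxPoint`); midpoint convexity and the parallelogram law give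
uniqueness. The projection is characterized by `IsKKT`, and existence of a KKT point is obtained
from pool-adjacent-violators, whose multipliers are differences of partial sums
(`exists_isKKT_pav`).

The multiplier is unique, since `Δ` has a right inverse. So `K ∈ indexSets z` says exactly that `z`
satisfies the KKT system with active constraints on `K` and multiplier supported in `K`. For fixed
`K` these `z` form a convex cone with nonempty interior, on which the projection is the linear map
`rowProj K`. The finitely many cones cover the space, and near `z` only cones containing `z` occur
(`eventually_indexSets_subset`). Hence limits of Jacobians are exactly the linear pieces of the
cones through the point, and increments to nearby points are reproduced without error.

The sorting permutation depends on the point, but this is harmless near `s`. Since `rho n` is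
strictly decreasing, a tie in `s` becomes a strict increase of `P s - rho n`, so its multiplier is
negative and stays negative nearby. The projection therefore remains constant on the ties of `s`,
and any permutation sorting `s` may be frozen (`Sorts.eventually_prox_eq`).

For the distinguished element, `K` is the whole active set: `rowProj K` averages over each maximal
run of tied rows and is the identity elsewhere, which is what `θ_s` and `Γ_s` encode. -/

lemma inner_eq_sum {ι : Type*} [Fintype ι] (x y : EuclideanSpace ℝ ι) :
    inner ℝ x y = ∑ i, x i * y i := by
  simp [PiLp.inner_apply, mul_comm]

lemma inner_toEuclideanLin_transpose {ι κ : Type*} [Fintype ι] [Fintype κ] [DecidableEq ι]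
    [DecidableEq κ] (A : Matrix ι κ ℝ) (x : EuclideanSpace ℝ ι) (y : EuclideanSpace ℝ κ) :
    inner ℝ (Aᵀ.toEuclideanLin x) y = inner ℝ x (A.toEuclideanLin y) := by
  have h := LinearMap.adjoint_inner_left A.toEuclideanLin y x
  rwa [← Matrix.toEuclideanLin_conjTranspose_eq_adjoint,
    Matrix.conjTranspose_eq_transpose_of_trivial] at h

lemma diffMat_apply {n : ℕ} (y : EuclideanSpace ℝ (Fin n)) (i : Fin (n - 1)) :
    (diffMat n).toEuclideanLin y i = y ⟨i, by omega⟩ - y ⟨i + 1, by omega⟩ := by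
  have h : ∀ j : Fin n, diffMat n i j * y j =
      (if j = ⟨i, by omega⟩ then y j else 0) - (if j = ⟨i + 1, by omega⟩ then y j else 0) := by
    intro j
    have h1 : (j = ⟨i, by omega⟩) ↔ (j : ℕ) = i := by rw [Fin.ext_iff]
    have h2 : (j = ⟨i + 1, by omega⟩) ↔ (j : ℕ) = i + 1 := by rw [Fin.ext_iff]
    simp only [diffMat, Matrix.of_apply, h1, h2]
    split_ifs <;> first | omega | simp
  rw [Matrix.toLpLin_apply]
  simp only [Matrix.mulVec, dotProduct, h, Finset.sum_sub_distrib, Finset.sum_ite_eq',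
    Finset.mem_univ, if_true]

/-- The transpose of the difference matrix takes differences of the multipliers, padded by zeros on
both sides. -/
lemma diffMat_transpose_apply {n : ℕ} (c : ℕ → ℝ) (h0 : c 0 = 0) (hn : c n = 0)
    (μ : EuclideanSpace ℝ (Fin (n - 1))) (hμ : ∀ i, μ i = c (i + 1)) (k : Fin n) :
    (diffMat n)ᵀ.toEuclideanLin μ k = c (k + 1) - c k := by
  have hk := k.2
  have e : (diffMat n)ᵀ.toEuclideanLin μ k = ∑ i ∈ Finset.range (n - 1),
      ((if i = (k : ℕ) then c (i + 1) else 0) - (if i + 1 = (k : ℕ) then c (i + 1) else 0)) := by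
    rw [Matrix.toLpLin_apply, ← Fin.sum_univ_eq_sum_range]
    simp only [Matrix.mulVec, dotProduct]
    refine Finset.sum_congr rfl fun i _ => ?_
    simp only [Matrix.transpose_apply, diffMat, Matrix.of_apply, hμ]
    split_ifs <;> first | omega | simp
  rw [e, Finset.sum_sub_distrib]
  congr 1
  · rw [Finset.sum_ite_eq']
    split_ifs with h
    · rfl
    · have : (k : ℕ) + 1 = n := by simp at h; omega
      rw [this, hn]
  · rcases Nat.eq_zero_or_pos (k : ℕ) with h | h
    · rw [h, h0]
      simp
    · rw [Finset.sum_eq_single (k - 1 : ℕ)]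
      · rw [if_pos (by omega)]
        congr 1
        omega
      · intro b _ hb
        rw [if_neg (by omega)]
      · intro hb
        simp at hb
        omega

lemma mem_monoCone {n : ℕ} {y : EuclideanSpace ℝ (Fin n)} :
    y ∈ monoCone n ↔ Antitone fun k => y k := by
  simp only [monoCone, Set.mem_ofPred_eq, diffMat_apply, sub_nonneg]
  constructor
  · intro h
    cases n with
    | zero => intro a; exact a.elim0
    | succ m => exact Fin.antitone_iff_succ_le.2 fun i => h i
  · intro h i
    exact h (by simp)

/-! ### Optimality conditions for the projection -/

/-- Optimality conditions for the projection `y` of `z` onto the monotone cone, with the multiplier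
`μ` supported in `K` and all constraints indexed by `K` active. -/
structure IsKKT {n : ℕ} (K : Set (Fin (n - 1))) (z y : EuclideanSpace ℝ (Fin n))
    (μ : EuclideanSpace ℝ (Fin (n - 1))) : Prop where
  primal : ∀ i, 0 ≤ (diffMat n).toEuclideanLin y i
  dual : ∀ i, μ i ≤ 0
  stationary : (diffMat n)ᵀ.toEuclideanLin μ = z - y
  active : ∀ i ∈ K, (diffMat n).toEuclideanLin y i = 0
  supported : ∀ i, i ∉ K → μ i = 0

namespace IsKKT

variable {n : ℕ} {K : Set (Fin (n - 1))} {z y z' y' : EuclideanSpace ℝ (Fin n)}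
  {μ μ' : EuclideanSpace ℝ (Fin (n - 1))}

/-- For fixed `K` every KKT condition is linear or a sign condition, so the solutions form a convex
cone; this and `smul` make the set of `z` having `K` as an index set a convex cone. -/
lemma add (h : IsKKT K z y μ) (h' : IsKKT K z' y' μ') :
    IsKKT K (z + z') (y + y') (μ + μ') where
  primal i := by simpa using add_nonneg (h.primal i) (h'.primal i)
  dual i := by simpa using add_nonpos (h.dual i) (h'.dual i)
  stationary := by rw [map_add, h.stationary, h'.stationary]; abel
  active i hi := by rw [map_add, PiLp.add_apply, h.active i hi, h'.active i hi, add_zero]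
  supported i hi := by rw [PiLp.add_apply, h.supported i hi, h'.supported i hi, add_zero]

lemma smul (h : IsKKT K z y μ) {t : ℝ} (ht : 0 ≤ t) : IsKKT K (t • z) (t • y) (t • μ) where
  primal i := by simpa using mul_nonneg ht (h.primal i)
  dual i := by simpa using mul_nonpos_of_nonneg_of_nonpos ht (h.dual i)
  stationary := by rw [map_smul, h.stationary, smul_sub]
  active i hi := by rw [map_smul, PiLp.smul_apply, h.active i hi, smul_zero]
  supported i hi := by rw [PiLp.smul_apply, h.supported i hi, smul_zero]

lemma mem_monoCone (h : IsKKT K z y μ) : y ∈ monoCone n := h.primal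

/-- Complementary slackness, term by term: on `K` the contribution of `y` drops out and the signs
are opposite; off `K` the multiplier vanishes. -/
lemma inner_le (h : IsKKT K z y μ) {w : EuclideanSpace ℝ (Fin n)} (hw : w ∈ monoCone n) :
    inner ℝ (z - y) (w - y) ≤ 0 := by
  rw [← h.stationary, inner_toEuclideanLin_transpose, map_sub, inner_eq_sum]
  refine Finset.sum_nonpos fun i _ => ?_
  rw [PiLp.sub_apply]
  by_cases hi : i ∈ K
  · rw [h.active i hi, sub_zero]
    exact mul_nonpos_of_nonpos_of_nonneg (h.dual i) (hw i)
  · rw [h.supported i hi, zero_mul]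

/-- Optimality with quadratic growth, which yields minimality and uniqueness of the nearest point at
once. -/
lemma norm_sq_add_le (h : IsKKT K z y μ) {w : EuclideanSpace ℝ (Fin n)} (hw : w ∈ monoCone n) :
    ‖z - y‖ ^ 2 + ‖w - y‖ ^ 2 ≤ ‖z - w‖ ^ 2 := by
  have e : z - w = (z - y) - (w - y) := by abel
  rw [e, norm_sub_sq_real (z - y)]
  linarith [h.inner_le hw]

lemma isNearestPoint (h : IsKKT K z y μ) : IsNearestPoint (monoCone n) z y := by
  refine ⟨h.mem_monoCone, fun w hw => ?_⟩
  have := h.norm_sq_add_le hw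
  exact le_of_sq_le_sq (by nlinarith [sq_nonneg ‖w - y‖]) (norm_nonneg _)

lemma eq_of_isNearestPoint (h : IsKKT K z y μ) {p : EuclideanSpace ℝ (Fin n)}
    (hp : IsNearestPoint (monoCone n) z p) : p = y := by
  have h1 := h.norm_sq_add_le hp.1
  have h2 := hp.2 y h.mem_monoCone
  have h3 : ‖z - p‖ ^ 2 ≤ ‖z - y‖ ^ 2 := by gcongr
  have h4 : ‖p - y‖ ^ 2 = 0 := le_antisymm (by linarith) (sq_nonneg _)
  exact sub_eq_zero.1 (norm_eq_zero.1 (by simpa using h4))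

lemma eq_proj (h : IsKKT K z y μ) : y = proj (monoCone n) z :=
  (h.eq_of_isNearestPoint (Classical.epsilon_spec (p := IsNearestPoint (monoCone n) z)
    ⟨y, h.isNearestPoint⟩)).symm

end IsKKT
/-! ### Correctness of the pool-adjacent-violators algorithm -/

/-- `b` is the block `(total, size)` of the list `w`, and no initial segment of `w` has a larger
average than `w`. -/
structure IsBlock (w : List ℝ) (b : ℝ × ℕ) : Prop where
  pos : 0 < b.2
  length : w.length = b.2
  sum : w.sum = b.1
  take_sum_le : ∀ k ≤ b.2, (w.take k).sum ≤ k * (b.1 / b.2)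

lemma isBlock_singleton (a : ℝ) : IsBlock [a] (a, 1) where
  pos := one_pos
  length := rfl
  sum := by simp
  take_sum_le k hk := by
    simp only at hk
    interval_cases k <;> simp

/-- The pooled average `m` lies between the two averages. An initial segment inside `w'` averages at
most that of `c`, hence at most `m`; one reaching into `w` leaves out a tail averaging at least that
of `b`, hence at least `m`. -/
lemma IsBlock.append {w w' : List ℝ} {b c : ℝ × ℕ} (hc : IsBlock w' c) (hb : IsBlock w b)
    (h : c.1 / c.2 < b.1 / b.2) : IsBlock (w' ++ w) (c.1 + b.1, c.2 + b.2) := by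
  have hcp : (0 : ℝ) < c.2 := by exact_mod_cast hc.pos
  have hbp : (0 : ℝ) < b.2 := by exact_mod_cast hb.pos
  have h' := (div_lt_div_iff₀ hcp hbp).1 h
  have hl : c.1 / c.2 ≤ (c.1 + b.1) / (c.2 + b.2 : ℝ) := by
    rw [div_le_div_iff₀ hcp (by positivity)]
    nlinarith
  have hr : (c.1 + b.1) / (c.2 + b.2 : ℝ) ≤ b.1 / b.2 := by
    rw [div_le_div_iff₀ (by positivity) hbp]
    nlinarith
  have hm : (c.2 + b.2 : ℝ) * ((c.1 + b.1) / (c.2 + b.2 : ℝ)) = c.1 + b.1 := by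
    field_simp
  have hbm : (b.2 : ℝ) * (b.1 / b.2) = b.1 := by field_simp
  refine ⟨by have := hb.pos; simp; omega, by simp [hc.length, hb.length],
    by simp [hc.sum, hb.sum], fun k hk => ?_⟩
  simp only [Nat.cast_add] at hk ⊢
  generalize (c.1 + b.1) / (c.2 + b.2 : ℝ) = m at *
  rcases le_total k c.2 with hkc | hkc
  · rw [List.take_append_of_le_length (by rw [hc.length]; exact hkc)]
    refine (hc.take_sum_le k hkc).trans ?_
    gcongr
  · obtain ⟨j, rfl⟩ := Nat.exists_eq_add_of_le hkc
    have hj : j ≤ b.2 := by omega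
    rw [List.take_append, List.sum_append, List.take_of_length_le (by rw [hc.length]; omega),
      hc.sum, hc.length, Nat.add_sub_cancel_left]
    have h1 := hb.take_sum_le j hj
    have hj' : (j : ℝ) ≤ b.2 := by exact_mod_cast hj
    push_cast
    nlinarith [mul_le_mul_of_nonneg_left hr (sub_nonneg.2 hj')]

/-- The stack `st` is a partition of `l` into blocks whose averages are nonincreasing. -/
inductive IsStack : List ℝ → List (ℝ × ℕ) → Prop
  | nil : IsStack [] []
  | cons {l : List ℝ} {st : List (ℝ × ℕ)} {w : List ℝ} {b : ℝ × ℕ} (h : IsStack l st)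
      (hb : IsBlock w b) (hh : ∀ c ∈ st.head?, b.1 / b.2 ≤ c.1 / c.2) : IsStack (l ++ w) (b :: st)

lemma IsStack.pavPush {l : List ℝ} {st : List (ℝ × ℕ)} (h : IsStack l st) {w : List ℝ}
    {b : ℝ × ℕ} (hb : IsBlock w b) : IsStack (l ++ w) (pavPush st b) := by
  induction h generalizing w b with
  | nil => exact IsStack.cons .nil hb (by simp)
  | @cons l st w' c h hc hh ih =>
    rw [RankLoss.pavPush]
    split_ifs with hlt
    · rw [List.append_assoc]
      exact ih (hc.append hb hlt)
    · exact (h.cons hc hh).cons hb (by simpa using hlt)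

lemma isStack_foldl (l : List ℝ) :
    IsStack l (l.foldl (fun st a => pavPush st (a, 1)) []) := by
  suffices H : ∀ l' st, IsStack l' st →
      IsStack (l' ++ l) (l.foldl (fun st a => pavPush st (a, 1)) st) from H [] [] .nil
  induction l with
  | nil => intro l' st h; simpa using h
  | cons a l ih =>
    intro l' st h
    have := ih _ _ (h.pavPush (isBlock_singleton a))
    simpa using this

/-- `Y` satisfies the optimality conditions of nonincreasing isotonic regression for `l`, in
cumulative form. -/
structure IsIsotonicFit (l Y : List ℝ) : Prop where
  length : Y.length = l.length
  sum : Y.sum = l.sum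
  sorted : Y.Pairwise (· ≥ ·)
  take_sum_le : ∀ k, (l.take k).sum ≤ (Y.take k).sum
  take_sum_eq : ∀ k (h : k + 1 < Y.length), Y[k] ≠ Y[k + 1] →
    (l.take (k + 1)).sum = (Y.take (k + 1)).sum

/-- At the seam both partial sums are complete, so they agree; inside the new block the fit is
constant, so no equality is demanded there. -/
lemma IsIsotonicFit.append {l Y w : List ℝ} {b : ℝ × ℕ} (h : IsIsotonicFit l Y)
    (hb : IsBlock w b) (hY : ∀ x ∈ Y, b.1 / b.2 ≤ x) :
    IsIsotonicFit (l ++ w) (Y ++ List.replicate b.2 (b.1 / b.2)) := by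
  have hbp : (0 : ℝ) < b.2 := by exact_mod_cast hb.pos
  have hbm : (b.2 : ℝ) * (b.1 / b.2) = b.1 := by field_simp
  refine ⟨by simp [h.length, hb.length], by simp [h.sum, hb.sum, hbm], ?_, fun k => ?_,
    fun k hk hne => ?_⟩
  · rw [List.pairwise_append]
    refine ⟨h.sorted, List.pairwise_replicate.2 (Or.inr le_rfl), fun a ha c hc => ?_⟩
    rw [List.eq_of_mem_replicate hc]
    exact hY a ha
  · rcases le_total k l.length with hk | hk
    · rw [List.take_append_of_le_length hk, List.take_append_of_le_length (h.length ▸ hk)]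
      exact h.take_sum_le k
    · obtain ⟨j, rfl⟩ := Nat.exists_eq_add_of_le hk
      rw [List.take_append, List.take_append, List.take_of_length_le (l := l) hk,
        List.take_of_length_le (l := Y) (h.length ▸ hk), List.sum_append, List.sum_append, h.sum,
        h.length, Nat.add_sub_cancel_left]
      refine add_le_add le_rfl ?_
      rcases le_total j b.2 with hj | hj
      · simpa [List.take_replicate, hj] using hb.take_sum_le j hj
      · rw [List.take_of_length_le (hb.length ▸ hj), List.take_of_length_le (by simpa using hj)]
        simp [hb.sum, hbm]
  · rcases lt_trichotomy (k + 1) l.length with hl | hl | hl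
    · rw [List.take_append_of_le_length hl.le, List.take_append_of_le_length (by
        rw [h.length]; exact hl.le)]
      have hl' : k + 1 < Y.length := by rw [h.length]; exact hl
      refine h.take_sum_eq k hl' ?_
      rwa [List.getElem_append_left (by omega), List.getElem_append_left (by omega)] at hne
    · rw [List.take_left' hl.symm, List.take_left' (by rw [h.length]; exact hl.symm), h.sum]
    · refine absurd ?_ hne
      have := h.length
      rw [List.getElem_append_right (by omega), List.getElem_append_right (by omega)]
      simp

/-- The list of the averages of a stack of blocks, each repeated as often as its size says. -/
def blockAverages (st : List (ℝ × ℕ)) : List ℝ :=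
  st.reverse.flatMap fun b => List.replicate b.2 (b.1 / b.2)

lemma blockAverages_cons (b : ℝ × ℕ) (st : List (ℝ × ℕ)) :
    blockAverages (b :: st) = blockAverages st ++ List.replicate b.2 (b.1 / b.2) := by
  simp [blockAverages]

/-- The second conjunct strengthens the induction: the top block has the smallest average, so the
next block need only be compared with it. -/
lemma IsStack.isIsotonicFit {l : List ℝ} {st : List (ℝ × ℕ)} (h : IsStack l st) :
    IsIsotonicFit l (blockAverages st) ∧
      ∀ x ∈ blockAverages st, ∀ c ∈ st.head?, c.1 / c.2 ≤ x := by
  induction h with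
  | nil => exact ⟨⟨rfl, rfl, by simp [blockAverages], by simp [blockAverages],
      by simp [blockAverages]⟩, by simp⟩
  | @cons l st w b h hb hh ih =>
    have hY : ∀ x ∈ blockAverages st, b.1 / b.2 ≤ x := by
      intro x hx
      cases st with
      | nil => simp [blockAverages] at hx
      | cons c st => exact (hh c (by simp)).trans (ih.2 x hx c (by simp))
    rw [blockAverages_cons]
    refine ⟨ih.1.append hb hY, fun x hx c hc => ?_⟩
    obtain rfl : b = c := by simpa using hc
    rcases List.mem_append.1 hx with hx | hx
    · exact hY x hx
    · rw [List.eq_of_mem_replicate hx]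

lemma isIsotonicFit_pav (l : List ℝ) : IsIsotonicFit l (pav l) :=
  (isStack_foldl l).isIsotonicFit.1

/-- The optimality conditions have a solution, which the pool-adjacent-violators algorithm
computes. -/
lemma exists_isKKT_pav {n : ℕ} (z : EuclideanSpace ℝ (Fin n)) :
    ∃ y μ, IsKKT {i | (diffMat n).toEuclideanLin y i = 0} z y μ ∧
      List.ofFn (fun k => y k) = pav (List.ofFn fun k => z k) := by
  have h := isIsotonicFit_pav (List.ofFn fun k => z k)
  generalize pav (List.ofFn fun k => z k) = Y at h
  have hlen : Y.length = n := by simpa using h.length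
  set y : EuclideanSpace ℝ (Fin n) := WithLp.toLp 2 fun k => Y[(k : ℕ)]
  -- Partial sums of `z` minus partial sums of the fit invert `Δᵀ`; they vanish at both ends because
  -- the totals agree.
  set c : ℕ → ℝ := fun k => ((List.ofFn fun k => z k).take k).sum - (Y.take k).sum with hc
  set μ : EuclideanSpace ℝ (Fin (n - 1)) := WithLp.toLp 2 fun i => c (i + 1)
  refine ⟨y, μ, ⟨?_, fun i => sub_nonpos.2 (h.take_sum_le _), ?_, fun i hi => hi, fun i hi => ?_⟩,
    ?_⟩
  · intro i
    rw [diffMat_apply, sub_nonneg]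
    exact List.pairwise_iff_getElem.1 h.sorted i (i + 1) (by omega) (by omega) (Nat.lt_succ_self _)
  · ext k
    rw [diffMat_transpose_apply c (by simp [hc]) ?_ μ (fun i => rfl)]
    · simp only [hc]
      rw [List.sum_take_succ _ _ (by simp), List.sum_take_succ _ _ (by omega)]
      simp [y]
      ring
    · simp only [hc]
      rw [List.take_of_length_le (by simp), List.take_of_length_le (by omega), h.sum, sub_self]
  · refine sub_eq_zero.2 (h.take_sum_eq i (by omega) fun he => hi ?_)
    rw [Set.mem_ofPred_eq, diffMat_apply]
    exact sub_eq_zero.2 he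
  · refine List.ext_getElem (by simp [hlen]) fun i h1 h2 => ?_
    simp [y]

/-! ### The projection onto the monotone cone -/

lemma isNearestPoint_monoCone_iff {n : ℕ} (z p : EuclideanSpace ℝ (Fin n)) :
    IsNearestPoint (monoCone n) z p ↔ p = proj (monoCone n) z := by
  obtain ⟨y, μ, h, -⟩ := exists_isKKT_pav z
  rw [← h.eq_proj]
  exact ⟨h.eq_of_isNearestPoint, fun e => e ▸ h.isNearestPoint⟩

lemma ofFn_proj_monoCone {n : ℕ} (z : EuclideanSpace ℝ (Fin n)) :
    List.ofFn (fun k => proj (monoCone n) z k) = pav (List.ofFn fun k => z k) := by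
  obtain ⟨y, μ, h, hy⟩ := exists_isKKT_pav z
  rw [← h.eq_proj, hy]

/-- The vector `(1, …, 1, 0, …, 0)` with the last `1` in position `i`. -/
def stepVec {n : ℕ} (i : Fin (n - 1)) : EuclideanSpace ℝ (Fin n) :=
  WithLp.toLp 2 fun k => if (k : ℕ) ≤ i then 1 else 0

/-- The step vectors form a right inverse of `Δ`. This gives uniqueness of multipliers and
invertibility of the Gram matrices of its rows. -/
lemma diffMat_stepVec {n : ℕ} (i : Fin (n - 1)) :
    (diffMat n).toEuclideanLin (stepVec i) = EuclideanSpace.single i 1 := by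
  ext j
  rw [diffMat_apply, PiLp.single_apply]
  simp only [stepVec, Fin.ext_iff]
  split_ifs <;> first | omega | simp

/-- The multiplier of the projection onto the monotone cone. -/
def multiplier {n : ℕ} (z : EuclideanSpace ℝ (Fin n)) : EuclideanSpace ℝ (Fin (n - 1)) :=
  WithLp.toLp 2 fun i => inner ℝ (z - proj (monoCone n) z) (stepVec i)

section KKT

variable {n : ℕ} {z : EuclideanSpace ℝ (Fin n)}

/-- Pairing `Δᵀ μ = z - y` with a step vector isolates one coordinate of `μ`. -/
lemma IsKKT.eq_multiplier {K : Set (Fin (n - 1))} {y : EuclideanSpace ℝ (Fin n)}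
    {μ : EuclideanSpace ℝ (Fin (n - 1))} (h : IsKKT K z y μ) : μ = multiplier z := by
  ext i
  simp only [multiplier]
  rw [← h.eq_proj, ← h.stationary, inner_toEuclideanLin_transpose, diffMat_stepVec,
    EuclideanSpace.inner_single_right]
  simp

lemma IsKKT.proj {K : Set (Fin (n - 1))} {y : EuclideanSpace ℝ (Fin n)}
    {μ : EuclideanSpace ℝ (Fin (n - 1))} (h : IsKKT K z y μ) :
    IsKKT K z (proj (monoCone n) z) (multiplier z) := by
  rwa [← h.eq_proj, ← h.eq_multiplier]

lemma isKKT_activeSet (z : EuclideanSpace ℝ (Fin n)) :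
    IsKKT (activeSet z) z (proj (monoCone n) z) (multiplier z) := by
  obtain ⟨y, μ, h, -⟩ := exists_isKKT_pav z
  have e : {i | (diffMat n).toEuclideanLin y i = 0} = activeSet z := by
    rw [activeSet, ← h.eq_proj]
  rw [← e]
  exact h.proj

/-- Uniqueness of the multiplier collapses the existential to a single KKT system in which `K`
bounds both the support and the active set. -/
lemma mem_indexSets {K : Finset (Fin (n - 1))} :
    K ∈ indexSets z ↔ IsKKT K z (proj (monoCone n) z) (multiplier z) := by
  have h := isKKT_activeSet z
  constructor
  · rintro ⟨μ, ⟨hμ, hs, -⟩, hsupp, hK⟩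
    exact (IsKKT.mk (K := K) h.primal hμ hs (fun i hi => hK hi)
      (fun i hi => by_contra fun hne => hi (hsupp hne))).proj
  · intro hK
    exact ⟨multiplier z, ⟨h.dual, h.stationary, h.supported⟩,
      fun i hi => by_contra fun hne => hi (hK.supported i hne), fun i hi => hK.active i hi⟩

lemma mem_indexSets_of_isKKT {K : Finset (Fin (n - 1))} {y : EuclideanSpace ℝ (Fin n)}
    {μ : EuclideanSpace ℝ (Fin (n - 1))} (h : IsKKT K z y μ) : K ∈ indexSets z :=
  mem_indexSets.2 h.proj

lemma exists_mem_indexSets_coe_eq_activeSet (z : EuclideanSpace ℝ (Fin n)) :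
    ∃ K ∈ indexSets z, (K : Set (Fin (n - 1))) = activeSet z := by
  have e : ((Set.toFinite (activeSet z)).toFinset : Set (Fin (n - 1))) = activeSet z :=
    Set.Finite.coe_toFinset _
  refine ⟨(Set.toFinite (activeSet z)).toFinset, mem_indexSets.2 ?_, e⟩
  rw [e]
  exact isKKT_activeSet z

lemma indexSets_nonempty (z : EuclideanSpace ℝ (Fin n)) : (indexSets z).Nonempty :=
  let ⟨K, hK, _⟩ := exists_mem_indexSets_coe_eq_activeSet z
  ⟨K, hK⟩

/-- Add the variational inequalities at the two points, each tested with the other projection, and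
apply Cauchy–Schwarz. -/
lemma norm_proj_sub_proj_le (z z' : EuclideanSpace ℝ (Fin n)) :
    ‖proj (monoCone n) z - proj (monoCone n) z'‖ ≤ ‖z - z'‖ := by
  have h := isKKT_activeSet z
  have h' := isKKT_activeSet z'
  have h1 := h.inner_le h'.mem_monoCone
  have h2 := h'.inner_le h.mem_monoCone
  set y := RankLoss.proj (monoCone n) z
  set y' := RankLoss.proj (monoCone n) z'
  have h3 : inner ℝ (z - z') (y - y') - ‖y - y'‖ ^ 2 =
      - inner ℝ (z - y) (y' - y) - inner ℝ (z' - y') (y - y') := by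
    rw [← real_inner_self_eq_norm_sq]
    simp only [inner_sub_left, inner_sub_right]
    ring
  have h4 := real_inner_le_norm (z - z') (y - y')
  by_contra! hlt
  have h5 := mul_lt_mul_of_pos_right hlt ((norm_nonneg _).trans_lt hlt)
  nlinarith

lemma lipschitzWith_proj_monoCone : LipschitzWith 1 (proj (monoCone n)) :=
  LipschitzWith.of_dist_le_mul fun z z' => by
    simpa [dist_eq_norm] using norm_proj_sub_proj_le z z'

lemma continuous_proj_monoCone : Continuous (proj (monoCone n)) :=
  lipschitzWith_proj_monoCone.continuous

lemma continuous_multiplier (i : Fin (n - 1)) :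
    Continuous fun z : EuclideanSpace ℝ (Fin n) => multiplier z i :=
  (continuous_id.sub continuous_proj_monoCone).inner continuous_const

lemma eventually_multiplier_neg {i : Fin (n - 1)} (h : multiplier z i < 0) :
    ∀ᶠ z' in 𝓝 z, multiplier z' i < 0 :=
  (continuous_multiplier i).continuousAt.eventually_lt_const h

/-- The index sets of a neighbouring point are index sets of the given point. -/
lemma eventually_indexSets_subset (z : EuclideanSpace ℝ (Fin n)) :
    ∀ᶠ z' in 𝓝 z, indexSets z' ⊆ indexSets z := by
  have h := isKKT_activeSet z
  -- Only strict conditions at `z` have to persist: negative multipliers force membership in `K`,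
  -- positive gaps force non-membership.
  have h1 : ∀ᶠ z' in 𝓝 z, ∀ i, multiplier z i < 0 → multiplier z' i < 0 := by
    refine eventually_all.2 fun i => ?_
    by_cases hi : multiplier z i < 0
    · filter_upwards [eventually_multiplier_neg hi] with z' hz' _ using hz'
    · exact Eventually.of_forall fun z' h => absurd h hi
  have h2 : ∀ᶠ z' in 𝓝 z, ∀ i, 0 < (diffMat n).toEuclideanLin (proj (monoCone n) z) i →
      0 < (diffMat n).toEuclideanLin (proj (monoCone n) z') i := by
    refine eventually_all.2 fun i => ?_
    by_cases hi : 0 < (diffMat n).toEuclideanLin (proj (monoCone n) z) i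
    · have hc : Continuous fun z' => (diffMat n).toEuclideanLin (proj (monoCone n) z') i :=
        (EuclideanSpace.proj (𝕜 := ℝ) i).continuous.comp
          ((LinearMap.continuous_of_finiteDimensional (diffMat n).toEuclideanLin).comp
            continuous_proj_monoCone)
      filter_upwards [hc.continuousAt.eventually_const_lt hi] with z' hz' _ using hz'
    · exact Eventually.of_forall fun z' h => absurd h hi
  filter_upwards [h1, h2] with z' h1 h2 K hK
  have hK' := mem_indexSets.1 hK
  refine mem_indexSets.2 ⟨h.primal, h.dual, h.stationary, fun i hi => ?_, fun i hi => ?_⟩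
  · by_contra hne
    exact (h2 i (lt_of_le_of_ne (h.primal i) (Ne.symm hne))).ne' (hK'.active i hi)
  · by_contra hne
    exact (h1 i (lt_of_le_of_ne (h.dual i) hne)).ne (hK'.supported i hi)

end KKT

/-! ### Projections onto the kernels of the row submatrices -/

section RowProj

variable {n : ℕ} (K : Finset (Fin (n - 1)))

lemma diffRows_mulVec (y : EuclideanSpace ℝ (Fin n)) :
    diffRows K *ᵥ (y : Fin n → ℝ) = fun i : K => (diffMat n).toEuclideanLin y i := by
  rw [Matrix.toLpLin_apply]
  rfl

lemma diffRows_transpose_mulVec (μ : EuclideanSpace ℝ (Fin (n - 1))) (hμ : ∀ i, i ∉ K → μ i = 0) :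
    (diffRows K)ᵀ *ᵥ (fun i : K => μ i) = (diffMat n)ᵀ.toEuclideanLin μ := by
  ext k
  rw [Matrix.toLpLin_apply]
  simp only [Matrix.mulVec, dotProduct, Matrix.transpose_apply, diffRows, Matrix.submatrix_apply,
    id_eq]
  rw [Finset.sum_coe_sort K fun i => diffMat n i k * μ i]
  refine Finset.sum_subset (Finset.subset_univ _) fun i _ hi => ?_
  rw [hμ i hi, mul_zero]

/-- The right inverse by step vectors makes the rows independent, so their Gram matrix is positive
definite. -/
lemma isUnit_diffRows_mul_transpose : IsUnit (diffRows K * (diffRows K)ᵀ) := by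
  have h1 : diffRows K * Matrix.of (fun (k : Fin n) (j : K) => stepVec (j : Fin (n - 1)) k) = 1 := by
    ext i j
    have h := congrFun (diffRows_mulVec K (stepVec (j : Fin (n - 1)))) i
    rw [diffMat_stepVec, PiLp.single_apply] at h
    rw [Matrix.one_apply, Matrix.mul_apply]
    simp only [Subtype.ext_iff]
    exact h
  have hinj : Function.Injective (diffRows K).vecMul := by
    intro v w hvw
    have := congrArg
      (fun u => u ᵥ* Matrix.of (fun (k : Fin n) (j : K) => stepVec (j : Fin (n - 1)) k)) hvw
    simpa [Matrix.vecMul_vecMul, h1] using this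
  have := (Matrix.PosDef.mul_conjTranspose_self (diffRows K) hinj).isUnit
  rwa [Matrix.conjTranspose_eq_transpose_of_trivial] at this

/-- The orthogonal projection `I - Δ_Kᵀ (Δ_K Δ_Kᵀ)⁻¹ Δ_K` onto the kernel of `Δ_K`. -/
def rowProj : Matrix (Fin n) (Fin n) ℝ :=
  1 - (diffRows K)ᵀ * (diffRows K * (diffRows K)ᵀ)⁻¹ * diffRows K

lemma diffRows_mul_rowProj : diffRows K * rowProj K = 0 := by
  have h := (Matrix.isUnit_iff_isUnit_det _).1 (isUnit_diffRows_mul_transpose K)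
  rw [rowProj, Matrix.mul_sub, Matrix.mul_one, ← Matrix.mul_assoc, ← Matrix.mul_assoc,
    Matrix.mul_nonsing_inv _ h, Matrix.one_mul, sub_self]

lemma rowProj_transpose : (rowProj K)ᵀ = rowProj K := by
  simp [rowProj, Matrix.transpose_sub, Matrix.transpose_mul, Matrix.transpose_nonsing_inv,
    Matrix.mul_assoc]

lemma rowProj_mul_transpose : rowProj K * (diffRows K)ᵀ = 0 := by
  have := congrArg Matrix.transpose (diffRows_mul_rowProj K)
  rwa [Matrix.transpose_mul, rowProj_transpose, Matrix.transpose_zero] at this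

lemma rowProj_mul_of_diffRows_mul_eq_zero {ι : Type*} (B : Matrix (Fin n) ι ℝ)
    (h : diffRows K * B = 0) : rowProj K * B = B := by
  rw [rowProj, Matrix.sub_mul, Matrix.one_mul, Matrix.mul_assoc, h, Matrix.mul_zero, sub_zero]

variable {K}

lemma rowProj_apply_of_eq_zero {y : EuclideanSpace ℝ (Fin n)}
    (hy : ∀ i ∈ K, (diffMat n).toEuclideanLin y i = 0) : (rowProj K).toEuclideanLin y = y := by
  have h : diffRows K *ᵥ (y : Fin n → ℝ) = 0 := by
    rw [diffRows_mulVec]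
    exact funext fun i => hy i i.2
  rw [Matrix.toLpLin_apply, rowProj, Matrix.sub_mulVec, Matrix.one_mulVec, ← Matrix.mulVec_mulVec, h,
    Matrix.mulVec_zero, sub_zero]

lemma rowProj_apply_transpose {μ : EuclideanSpace ℝ (Fin (n - 1))} (hμ : ∀ i, i ∉ K → μ i = 0) :
    (rowProj K).toEuclideanLin ((diffMat n)ᵀ.toEuclideanLin μ) = 0 := by
  rw [Matrix.toLpLin_apply, ← diffRows_transpose_mulVec K μ hμ, Matrix.mulVec_mulVec,
    rowProj_mul_transpose, Matrix.zero_mulVec]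
  rfl

lemma diffMat_rowProj (e : EuclideanSpace ℝ (Fin n)) (i : Fin (n - 1)) (hi : i ∈ K) :
    (diffMat n).toEuclideanLin ((rowProj K).toEuclideanLin e) i = 0 := by
  have h := congrFun (diffRows_mulVec K ((rowProj K).toEuclideanLin e)) ⟨i, hi⟩
  rw [← h, Matrix.toLpLin_apply, Matrix.mulVec_mulVec, diffRows_mul_rowProj, Matrix.zero_mulVec]
  rfl

/-- The residual lies in the row space of `Δ_K`. Extending its coefficients by zero splits a vector
into a primal part in the kernel and a dual part supported on `K`. -/
lemma exists_sub_rowProj_eq (K : Finset (Fin (n - 1))) (e : EuclideanSpace ℝ (Fin n)) :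
    ∃ ν : EuclideanSpace ℝ (Fin (n - 1)), (∀ i, i ∉ K → ν i = 0) ∧
      (diffMat n)ᵀ.toEuclideanLin ν = e - (rowProj K).toEuclideanLin e := by
  set w : K → ℝ := ((diffRows K * (diffRows K)ᵀ)⁻¹ * diffRows K) *ᵥ (e : Fin n → ℝ) with hw
  refine ⟨WithLp.toLp 2 fun i => if h : i ∈ K then w ⟨i, h⟩ else 0, fun i hi => dif_neg hi, ?_⟩
  have h := diffRows_transpose_mulVec K (WithLp.toLp 2 fun i => if h : i ∈ K then w ⟨i, h⟩ else 0)
    (fun i hi => dif_neg hi)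
  have hf : (fun i : K => if h : (i : Fin (n - 1)) ∈ K then w ⟨i, h⟩ else 0) = w :=
    funext fun i => dif_pos i.2
  simp only [hf] at h
  ext k
  rw [← h, hw, Matrix.mulVec_mulVec, PiLp.sub_apply, Matrix.toLpLin_apply, rowProj,
    Matrix.sub_mulVec, Matrix.one_mulVec, Matrix.mul_assoc]
  simp

/-- In `z = y + Δᵀ μ` the first term lies in the kernel of `Δ_K` and the second in the span of its
rows, so the matrix keeps the one and kills the other. -/
lemma IsKKT.rowProj_apply {z y : EuclideanSpace ℝ (Fin n)} {μ : EuclideanSpace ℝ (Fin (n - 1))}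
    (h : IsKKT K z y μ) : (rowProj K).toEuclideanLin z = y := by
  have e : z = y + (diffMat n)ᵀ.toEuclideanLin μ := by rw [h.stationary]; abel
  rw [e, map_add, rowProj_apply_of_eq_zero h.active,
    rowProj_apply_transpose h.supported, add_zero]

lemma proj_eq_rowProj {z : EuclideanSpace ℝ (Fin n)} (h : K ∈ indexSets z) :
    proj (monoCone n) z = (rowProj K).toEuclideanLin z :=
  (mem_indexSets.1 h).rowProj_apply.symm

lemma add_mem_indexSets {z z' : EuclideanSpace ℝ (Fin n)} (h : K ∈ indexSets z)
    (h' : K ∈ indexSets z') : K ∈ indexSets (z + z') :=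
  mem_indexSets_of_isKKT ((mem_indexSets.1 h).add (mem_indexSets.1 h'))

lemma smul_mem_indexSets {z : EuclideanSpace ℝ (Fin n)} (h : K ∈ indexSets z) {t : ℝ}
    (ht : 0 ≤ t) : K ∈ indexSets (t • z) :=
  mem_indexSets_of_isKKT ((mem_indexSets.1 h).smul ht)

/-- There is a direction all of whose small perturbations have the index set `K`, and only `K`. -/
lemma exists_interior_direction (K : Finset (Fin (n - 1))) :
    ∃ d : EuclideanSpace ℝ (Fin n),
      (∀ z, K ∈ indexSets z → ∀ t : ℝ, 0 < t → indexSets (z + t • d) = {K}) ∧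
      ∀ e, ∃ ε : ℝ, 0 < ε ∧ K ∈ indexSets (d + ε • e) := by
  -- Strict complementarity: `p` has gap `1` off `K` and `0` on `K`, while `ν` is `-1` on `K` and
  -- `0` off `K`; the direction is `p + Δᵀ ν`.
  set p : EuclideanSpace ℝ (Fin n) := ∑ i ∈ Kᶜ, stepVec i with hp
  set ν : EuclideanSpace ℝ (Fin (n - 1)) := WithLp.toLp 2 fun i => if i ∈ K then -1 else 0 with hν
  have hdp : ∀ i, (diffMat n).toEuclideanLin p i = if i ∈ K then 0 else 1 := by
    intro i
    rw [hp, map_sum, WithLp.ofLp_sum, Finset.sum_apply]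
    simp only [diffMat_stepVec, PiLp.single_apply]
    rw [Finset.sum_ite_eq]
    simp only [Finset.mem_compl]
    split_ifs <;> simp_all
  have hd : IsKKT K (p + (diffMat n)ᵀ.toEuclideanLin ν) p ν := by
    refine ⟨fun i => ?_, fun i => ?_, by abel, fun i hi => ?_, fun i hi => ?_⟩
    · rw [hdp]; split_ifs <;> simp
    · simp only [hν]; split_ifs <;> simp
    · rw [hdp, if_pos (by simpa using hi)]
    · exact if_neg (by simpa using hi)
  refine ⟨p + (diffMat n)ᵀ.toEuclideanLin ν, fun z hz t ht => ?_, fun e => ?_⟩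
  · have h := (mem_indexSets.1 hz).add (hd.smul ht.le)
    refine Set.eq_singleton_iff_unique_mem.2 ⟨mem_indexSets_of_isKKT h, fun K' hK' => ?_⟩
    have h0 := mem_indexSets.1 hz
    have h' := mem_indexSets.1 hK'
    rw [← h.eq_proj, ← h.eq_multiplier] at h'
    ext i
    constructor
    · intro hi
      by_contra hiK
      have h1 := h'.active i hi
      rw [map_add, map_smul, PiLp.add_apply, PiLp.smul_apply, hdp, if_neg hiK] at h1
      have h2 := h0.primal i
      simp only [smul_eq_mul, mul_one] at h1
      linarith
    · intro hi
      by_contra hiK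
      have h1 := h'.supported i (by simpa using hiK)
      simp only [PiLp.add_apply, PiLp.smul_apply, hν, if_pos hi, smul_eq_mul] at h1
      have h2 := h0.dual i
      linarith
  · obtain ⟨η, hη, hηe⟩ := exists_sub_rowProj_eq K e
    set q := (rowProj K).toEuclideanLin e with hq
    -- `M` dominates every gap of `q` and every coefficient of `η`, so after scaling by `M⁻¹` they
    -- cannot overturn the margins `1` and `-1`.
    set M : ℝ := 1 + ∑ i, |(diffMat n).toEuclideanLin q i| + ∑ i, |η i| with hM
    have hM1 : ∀ i, |(diffMat n).toEuclideanLin q i| ≤ M := fun i => by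
      have h1 := Finset.single_le_sum (f := fun i => |(diffMat n).toEuclideanLin q i|)
        (fun i _ => abs_nonneg _) (Finset.mem_univ i)
      have h2 := Finset.sum_nonneg (s := Finset.univ) (f := fun i => |η i|)
        (fun i _ => abs_nonneg _)
      simp only at h1
      linarith
    have hM2 : ∀ i, |η i| ≤ M := fun i => by
      have h1 := Finset.single_le_sum (f := fun i => |η i|)
        (fun i _ => abs_nonneg _) (Finset.mem_univ i)
      have h2 := Finset.sum_nonneg (s := Finset.univ)
        (f := fun i => |(diffMat n).toEuclideanLin q i|) (fun i _ => abs_nonneg _)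
      simp only at h1
      linarith
    have hM0 : 0 < M := by positivity
    have key : ∀ x : ℝ, |x| ≤ M → |M⁻¹ * x| ≤ 1 := fun x hx => by
      rw [abs_mul, abs_of_pos (inv_pos.2 hM0), inv_mul_le_iff₀ hM0]
      simpa using hx
    refine ⟨M⁻¹, inv_pos.2 hM0, mem_indexSets_of_isKKT (y := p + M⁻¹ • q) (μ := ν + M⁻¹ • η)
      ⟨fun i => ?_, fun i => ?_, ?_, fun i hi => ?_, fun i hi => ?_⟩⟩
    · rw [map_add, map_smul, PiLp.add_apply, PiLp.smul_apply, hdp, smul_eq_mul]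
      split_ifs with hi
      · rw [hq, diffMat_rowProj e i hi]
        simp
      · linarith [neg_le_of_abs_le (key _ (hM1 i))]
    · simp only [PiLp.add_apply, PiLp.smul_apply, hν, smul_eq_mul]
      split_ifs with hi
      · linarith [le_of_abs_le (key _ (hM2 i))]
      · rw [hη i hi]
        simp
    · rw [map_add, map_smul, hηe, smul_sub]
      abel
    · rw [map_add, map_smul, PiLp.add_apply, PiLp.smul_apply, hdp, if_pos (by simpa using hi), hq,
        diffMat_rowProj e i (by simpa using hi)]
      simp
    · simp only [PiLp.add_apply, PiLp.smul_apply, hν]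
      rw [hη i (by simpa using hi), if_neg (by simpa using hi)]
      simp

end RowProj

/-! ### Permutation matrices as isometries -/

variable {n : ℕ}

lemma permMatrix_apply (σ : Equiv.Perm (Fin n)) (x : EuclideanSpace ℝ (Fin n)) (k : Fin n) :
    (σ.permMatrix ℝ).toEuclideanLin x k = x (σ k) := by
  rw [Matrix.toLpLin_apply, Matrix.permMatrix_mulVec]
  rfl

lemma permMatrix_transpose_apply (σ : Equiv.Perm (Fin n)) (x : EuclideanSpace ℝ (Fin n))
    (k : Fin n) : (σ.permMatrix ℝ)ᵀ.toEuclideanLin x k = x (σ.symm k) := by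
  rw [Matrix.transpose_permMatrix, permMatrix_apply]
  rfl

lemma permMatrix_transpose_permMatrix (σ : Equiv.Perm (Fin n)) (x : EuclideanSpace ℝ (Fin n)) :
    (σ.permMatrix ℝ)ᵀ.toEuclideanLin ((σ.permMatrix ℝ).toEuclideanLin x) = x := by
  ext k
  rw [permMatrix_transpose_apply, permMatrix_apply, Equiv.apply_symm_apply]

lemma permMatrix_permMatrix_transpose (σ : Equiv.Perm (Fin n)) (x : EuclideanSpace ℝ (Fin n)) :
    (σ.permMatrix ℝ).toEuclideanLin ((σ.permMatrix ℝ)ᵀ.toEuclideanLin x) = x := by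
  ext k
  rw [permMatrix_apply, permMatrix_transpose_apply, Equiv.symm_apply_apply]

lemma norm_permMatrix (σ : Equiv.Perm (Fin n)) (x : EuclideanSpace ℝ (Fin n)) :
    ‖(σ.permMatrix ℝ).toEuclideanLin x‖ = ‖x‖ := by
  rw [EuclideanSpace.norm_eq, EuclideanSpace.norm_eq]
  simp only [permMatrix_apply]
  rw [Equiv.sum_comp σ fun k => ‖x k‖ ^ 2]

lemma norm_permMatrix_transpose (σ : Equiv.Perm (Fin n)) (x : EuclideanSpace ℝ (Fin n)) :
    ‖(σ.permMatrix ℝ)ᵀ.toEuclideanLin x‖ = ‖x‖ := by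
  rw [Matrix.transpose_permMatrix, norm_permMatrix]

lemma exists_sorts (x : EuclideanSpace ℝ (Fin n)) : ∃ σ, Sorts σ x :=
  ⟨Tuple.sort fun k => -x k, fun _ _ h => neg_le_neg_iff.1 (Tuple.monotone_sort (fun k => -x k) h)⟩

/-! ### The rank loss and its proximal mapping -/

lemma rankLoss_eq (x : EuclideanSpace ℝ (Fin n)) :
    rankLoss n x = 1 / ((n : ℝ) * ((n : ℝ) - 1)) * ∑ i, ∑ j, |x i - x j| := by
  rw [rankLoss]
  congr 1
  exact Finset.sum_congr rfl fun i _ => Finset.sum_erase _ (by simp)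

lemma rankLoss_permMatrix (σ : Equiv.Perm (Fin n)) (x : EuclideanSpace ℝ (Fin n)) :
    rankLoss n ((σ.permMatrix ℝ).toEuclideanLin x) = rankLoss n x := by
  simp only [rankLoss_eq, permMatrix_apply]
  congr 1
  rw [← Equiv.sum_comp σ fun i => ∑ j, |x i - x j|]
  exact Finset.sum_congr rfl fun i _ => Equiv.sum_comp σ fun j => |x (σ i) - x j|

lemma sum_sign (i : Fin n) :
    ∑ j : Fin n, (if i < j then (1 : ℝ) else if j < i then -1 else 0) = n - 1 - 2 * i := by
  have h : ∀ j : Fin n, (if i < j then (1 : ℝ) else if j < i then -1 else 0) =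
      (if i < j then (1 : ℝ) else 0) - if j < i then 1 else 0 := fun j => by
    split_ifs with h1 h2
    · exact absurd h2 h1.asymm
    all_goals simp
  simp only [h, Finset.sum_sub_distrib, Finset.sum_boole]
  have h1 : Finset.univ.filter (fun j => i < j) = Finset.Ioi i := by ext; simp
  have h2 : Finset.univ.filter (fun j => j < i) = Finset.Iio i := by ext; simp
  rw [h1, h2, Fin.card_Ioi, Fin.card_Iio, Nat.cast_sub (by omega : (i : ℕ) ≤ n - 1),
    Nat.cast_sub (Fin.pos i : 1 ≤ n)]
  push_cast
  ring

/-- Write each term as `S i j * (a i - a j)` with the antisymmetric sign matrix `S`; antisymmetry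
doubles the first half, and the row sums of `S` are the coefficients. -/
lemma sum_abs_sub_of_antitone {a : Fin n → ℝ} (ha : Antitone a) :
    ∑ i, ∑ j, |a i - a j| = ∑ i : Fin n, 2 * (n - 1 - 2 * i) * a i := by
  set S : Fin n → Fin n → ℝ := fun i j => if i < j then 1 else if j < i then -1 else 0 with hS
  have habs : ∀ i j, |a i - a j| = S i j * a i - S i j * a j := by
    intro i j
    rcases lt_trichotomy i j with h | h | h
    · have := ha h.le
      rw [abs_of_nonneg (by linarith)]
      simp [hS, h]
    · simp [h]
    · have := ha h.le
      rw [abs_of_nonpos (by linarith)]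
      simp only [hS, h, h.asymm, if_true, if_false]
      ring
  have hanti : ∀ i j, S j i = - S i j := by
    intro i j
    rcases lt_trichotomy i j with h | h | h
    · simp [hS, h, h.asymm]
    · simp [hS, h]
    · simp [hS, h, h.asymm]
  have h1 : ∑ i, ∑ j, S i j * a j = - ∑ i, ∑ j, S i j * a i := by
    rw [Finset.sum_comm, ← Finset.sum_neg_distrib]
    refine Finset.sum_congr rfl fun i _ => ?_
    rw [← Finset.sum_neg_distrib]
    exact Finset.sum_congr rfl fun j _ => by rw [hanti i j]; ring
  simp only [habs, Finset.sum_sub_distrib]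
  rw [h1, sub_neg_eq_add, ← two_mul, Finset.mul_sum]
  refine Finset.sum_congr rfl fun i _ => ?_
  rw [← Finset.sum_mul, sum_sign]
  ring

lemma rankLoss_of_antitone {x : EuclideanSpace ℝ (Fin n)} (hx : Antitone fun k => x k) :
    rankLoss n x = inner ℝ (rho n) x := by
  rw [rankLoss_eq, sum_abs_sub_of_antitone hx, inner_eq_sum, Finset.mul_sum]
  refine Finset.sum_congr rfl fun i _ => ?_
  simp only [rho]
  ring

lemma rankLoss_midpoint_le (x y : EuclideanSpace ℝ (Fin n)) :
    rankLoss n ((1 / 2 : ℝ) • (x + y)) ≤ 1 / 2 * (rankLoss n x + rankLoss n y) := by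
  -- For `n ≤ 1` the denominator is zero and the coefficient is `0` by convention.
  have hc : 0 ≤ 1 / ((n : ℝ) * ((n : ℝ) - 1)) := by
    rcases Nat.eq_zero_or_pos n with h | h
    · simp [h]
    · have : (1 : ℝ) ≤ n := by exact_mod_cast h
      have : 0 ≤ (n : ℝ) - 1 := by linarith
      positivity
  have h : ∑ i, ∑ j, |((1 / 2 : ℝ) • (x + y)) i - ((1 / 2 : ℝ) • (x + y)) j| ≤
      1 / 2 * (∑ i, ∑ j, |x i - x j| + ∑ i, ∑ j, |y i - y j|) := by
    simp only [← Finset.sum_add_distrib, Finset.mul_sum]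
    refine Finset.sum_le_sum fun i _ => Finset.sum_le_sum fun j _ => ?_
    have e : ((1 / 2 : ℝ) • (x + y)) i - ((1 / 2 : ℝ) • (x + y)) j =
        1 / 2 * ((x i - x j) + (y i - y j)) := by
      simp only [PiLp.smul_apply, PiLp.add_apply, smul_eq_mul]
      ring
    rw [e, abs_mul, abs_of_pos (by norm_num : (0 : ℝ) < 1 / 2)]
    gcongr
    exact abs_add_le _ _
  rw [rankLoss_eq, rankLoss_eq, rankLoss_eq]
  calc _ ≤ _ := mul_le_mul_of_nonneg_left h hc
    _ = _ := by ring

/-- By the parallelogram law the objective at the midpoint is below the average by at least `‖p -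
q‖² / 8`. -/
lemma IsProxPoint.unique {x p q : EuclideanSpace ℝ (Fin n)} (hp : IsProxPoint (rankLoss n) x p)
    (hq : IsProxPoint (rankLoss n) x q) : p = q := by
  have h1 := isMinOn_iff.1 hp ((1 / 2 : ℝ) • (p + q)) (Set.mem_univ _)
  have h2 := isMinOn_iff.1 hq ((1 / 2 : ℝ) • (p + q)) (Set.mem_univ _)
  have h3 := rankLoss_midpoint_le p q
  have h4 := parallelogram_law_with_norm ℝ (p - x) (q - x)
  have e1 : (1 / 2 : ℝ) • (p + q) - x = (1 / 2 : ℝ) • ((p - x) + (q - x)) := by module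
  have e2 : p - x - (q - x) = p - q := by abel
  have h5 : ‖(1 / 2 : ℝ) • (p + q) - x‖ = 1 / 2 * ‖(p - x) + (q - x)‖ := by
    rw [e1, norm_smul]
    norm_num
  rw [h5] at h1 h2
  rw [e2] at h4
  have h6 : ‖p - q‖ * ‖p - q‖ = 0 := le_antisymm (by nlinarith) (by positivity)
  exact sub_eq_zero.1 (norm_eq_zero.1 (mul_self_eq_zero.1 h6))

lemma Sorts.antitone_permMatrix {σ : Equiv.Perm (Fin n)} {x : EuclideanSpace ℝ (Fin n)}
    (h : Sorts σ x) : Antitone fun k => (σ.permMatrix ℝ).toEuclideanLin x k := by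
  simp only [permMatrix_apply]
  exact h

/-- Sorting two vectors does not increase their distance. -/
lemma norm_permMatrix_sub_le {σ τ : Equiv.Perm (Fin n)} {x y : EuclideanSpace ℝ (Fin n)}
    (hσ : Sorts σ x) (hτ : Sorts τ y) :
    ‖(τ.permMatrix ℝ).toEuclideanLin y - (σ.permMatrix ℝ).toEuclideanLin x‖ ^ 2 ≤
      ‖y - x‖ ^ 2 := by
  rw [norm_sub_sq_real, norm_sub_sq_real, norm_permMatrix, norm_permMatrix]
  -- Rearrangement inequality: the similarly sorted pairing maximizes the inner product, and
  -- `τ.trans σ.symm` reindexes it to the original pairing.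
  have hm : Monovary (fun k => y (τ k)) (fun k => x (σ k)) := hτ.monovary hσ
  have h := hm.sum_mul_comp_perm_le_sum_mul (σ := τ.trans σ.symm)
  simp only [Equiv.trans_apply, Equiv.apply_symm_apply] at h
  rw [Equiv.sum_comp τ fun k => y k * x k] at h
  have h' : inner ℝ y x ≤ inner ℝ ((τ.permMatrix ℝ).toEuclideanLin y)
      ((σ.permMatrix ℝ).toEuclideanLin x) := by
    simpa only [inner_eq_sum, permMatrix_apply] using h
  linarith

/-- Completing the square: up to a term independent of `v`, the linearized objective is half the
squared distance to `w - rho n`. -/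
lemma inner_rho_add_half_norm_sq (v w : EuclideanSpace ℝ (Fin n)) :
    inner ℝ (rho n) v + 1 / 2 * ‖v - w‖ ^ 2 =
      1 / 2 * ‖(w - rho n) - v‖ ^ 2 + (inner ℝ (rho n) w - 1 / 2 * ‖rho n‖ ^ 2) := by
  rw [norm_sub_rev v w]
  have e : (w - rho n) - v = (w - v) - rho n := by abel
  rw [e, norm_sub_sq_real (w - v), inner_sub_left, real_inner_comm (rho n) w,
    real_inner_comm (rho n) v]
  ring

lemma Sorts.isProxPoint {σ : Equiv.Perm (Fin n)} {x : EuclideanSpace ℝ (Fin n)}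
    (hσ : Sorts σ x) : IsProxPoint (rankLoss n) x
      ((σ.permMatrix ℝ)ᵀ.toEuclideanLin (proj (monoCone n) (sortedShift σ x))) := by
  rw [IsProxPoint, isMinOn_iff]
  intro y _
  obtain ⟨τ, hτ⟩ := exists_sorts y
  have hp := isKKT_activeSet (sortedShift σ x)
  set p := proj (monoCone n) (sortedShift σ x) with hpdef
  have h1 : rankLoss n ((σ.permMatrix ℝ)ᵀ.toEuclideanLin p) = inner ℝ (rho n) p := by
    rw [← rankLoss_permMatrix σ, permMatrix_permMatrix_transpose]
    exact rankLoss_of_antitone (mem_monoCone.1 hp.mem_monoCone)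
  have h2 : ‖(σ.permMatrix ℝ)ᵀ.toEuclideanLin p - x‖ =
      ‖p - (σ.permMatrix ℝ).toEuclideanLin x‖ := by
    rw [← norm_permMatrix σ, map_sub, permMatrix_permMatrix_transpose]
  have h3 : rankLoss n y = inner ℝ (rho n) ((τ.permMatrix ℝ).toEuclideanLin y) := by
    rw [← rankLoss_permMatrix τ]
    exact rankLoss_of_antitone hτ.antitone_permMatrix
  have h4 := norm_permMatrix_sub_le hσ hτ
  have h5 := hp.isNearestPoint.2 _ (mem_monoCone.2 hτ.antitone_permMatrix)
  have h6 := inner_rho_add_half_norm_sq p ((σ.permMatrix ℝ).toEuclideanLin x)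
  have h7 := inner_rho_add_half_norm_sq ((τ.permMatrix ℝ).toEuclideanLin y)
    ((σ.permMatrix ℝ).toEuclideanLin x)
  rw [sortedShift] at h5
  have h8 := pow_le_pow_left₀ (norm_nonneg _) h5 2
  rw [h1, h2, h3]
  linarith

lemma isProxPoint_rankLoss_iff (x p : EuclideanSpace ℝ (Fin n)) :
    IsProxPoint (rankLoss n) x p ↔ p = prox (rankLoss n) x := by
  obtain ⟨σ, hσ⟩ := exists_sorts x
  have h : IsProxPoint (rankLoss n) x (prox (rankLoss n) x) :=
    Classical.epsilon_spec (p := IsProxPoint (rankLoss n) x) ⟨_, hσ.isProxPoint⟩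
  exact ⟨fun hp => hp.unique h, fun e => e ▸ h⟩

lemma Sorts.prox_eq {σ : Equiv.Perm (Fin n)} {x : EuclideanSpace ℝ (Fin n)} (hσ : Sorts σ x) :
    prox (rankLoss n) x =
      (σ.permMatrix ℝ)ᵀ.toEuclideanLin (proj (monoCone n) (sortedShift σ x)) :=
  ((isProxPoint_rankLoss_iff x _).1 hσ.isProxPoint).symm

/-! ### The proximal mapping near a point, with a fixed permutation -/

lemma rho_succ_lt (hn : 2 ≤ n) (i : Fin (n - 1)) :
    rho n ⟨i + 1, by omega⟩ < rho n ⟨i, by omega⟩ := by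
  have h1 : (2 : ℝ) ≤ n := by exact_mod_cast hn
  have h2 : 0 < (n : ℝ) * (n - 1) := mul_pos (by linarith) (by linarith)
  simp only [rho]
  rw [div_lt_div_iff_of_pos_right h2]
  push_cast
  linarith

/-- Where the projection strictly pools an increase, the multiplier is negative. -/
lemma multiplier_neg_of_lt {z : EuclideanSpace ℝ (Fin n)} (i : Fin (n - 1))
    (h : z ⟨i, by omega⟩ < z ⟨i + 1, by omega⟩) : multiplier z i < 0 := by
  have hz := isKKT_activeSet z
  refine lt_of_le_of_ne (hz.dual i) fun h0 => ?_
  set c : ℕ → ℝ := fun k => if hk : 0 < k ∧ k - 1 < n - 1 then multiplier z ⟨k - 1, hk.2⟩ else 0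
    with hc
  have hcle : ∀ k, c k ≤ 0 := fun k => by
    simp only [hc]
    split_ifs
    · exact hz.dual _
    · exact le_rfl
  have hci : c (i + 1) = 0 := by
    simp only [hc]
    rw [dif_pos ⟨by omega, by omega⟩]
    exact h0
  have hcn : c n = 0 := dif_neg (by omega)
  have key : ∀ k : Fin n, z k - proj (monoCone n) z k = c (k + 1) - c k := fun k => by
    rw [← diffMat_transpose_apply c (dif_neg (by simp)) hcn (multiplier z) _ k, hz.stationary]
    · rfl
    · intro j
      simp only [hc]
      rw [dif_pos ⟨by omega, by omega⟩]
      rfl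
  -- With a zero multiplier at `i`, `z i ≥ proj i ≥ proj (i + 1) ≥ z (i + 1)`, contradicting the
  -- increase.
  have h1 := key ⟨i, by omega⟩
  have h2 := key ⟨i + 1, by omega⟩
  simp only [hci] at h1 h2
  have h3 := hz.primal i
  rw [diffMat_apply] at h3
  linarith [hcle i, hcle (i + 1 + 1)]

/-- Between two tied indices of a monotone sequence all neighbours are tied, so equality propagates
along the chain. -/
lemma eq_of_antitone_of_eq {a y : Fin n → ℝ} (ha : Antitone a)
    (h : ∀ i : Fin (n - 1), a ⟨i, by omega⟩ = a ⟨i + 1, by omega⟩ →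
      y ⟨i, by omega⟩ = y ⟨i + 1, by omega⟩) {k l : Fin n} (hkl : a k = a l) : y k = y l := by
  wlog hle : k ≤ l generalizing k l
  · exact (this hkl.symm (le_of_not_ge hle)).symm
  have H : ∀ m (hm : k + m < n), k + m ≤ l → y ⟨k + m, hm⟩ = y k := by
    intro m
    induction m with
    | zero => intro _ _; rfl
    | succ m ih =>
      intro hm hml
      rw [← ih (by omega) (by omega)]
      refine (h ⟨k + m, by omega⟩ ?_).symm
      refine le_antisymm ?_ (ha (by simp))
      calc a ⟨k + m, _⟩ ≤ a k := ha (by simp [Fin.le_def])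
        _ = a l := hkl
        _ ≤ a ⟨k + m + 1, _⟩ := ha (by simp only [Fin.le_def]; omega)
  rw [← H (l - k) (by omega) (by omega)]
  congr 1
  simp only [Fin.ext_iff]
  omega

/-- Adding the two variational inequalities bounds `‖y' - y‖²` by the inner product of a vector `π z
- z` with `y' - y`; it vanishes because both projections are `π`-invariant. -/
lemma proj_sub_eq_of_comp_perm {z r : EuclideanSpace ℝ (Fin n)} {π : Equiv.Perm (Fin n)}
    (h1 : ∀ k, proj (monoCone n) (z - r) (π k) = proj (monoCone n) (z - r) k)
    (h2 : ∀ k, proj (monoCone n) ((π.permMatrix ℝ).toEuclideanLin z - r) (π k) =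
      proj (monoCone n) ((π.permMatrix ℝ).toEuclideanLin z - r) k) :
    proj (monoCone n) ((π.permMatrix ℝ).toEuclideanLin z - r) = proj (monoCone n) (z - r) := by
  have k1 := isKKT_activeSet (z - r)
  have k2 := isKKT_activeSet ((π.permMatrix ℝ).toEuclideanLin z - r)
  set y := proj (monoCone n) (z - r)
  set y' := proj (monoCone n) ((π.permMatrix ℝ).toEuclideanLin z - r)
  have i1 := k1.inner_le k2.mem_monoCone
  have i2 := k2.inner_le k1.mem_monoCone
  have e : inner ℝ ((π.permMatrix ℝ).toEuclideanLin z) (y - y') = inner ℝ z (y - y') := by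
    simp only [inner_eq_sum, permMatrix_apply]
    rw [← Equiv.sum_comp π fun k => z k * (y - y') k]
    refine Finset.sum_congr rfl fun k _ => ?_
    simp only [PiLp.sub_apply, h1, h2]
  have i3 : ‖y' - y‖ ^ 2 ≤ 0 := by
    rw [← real_inner_self_eq_norm_sq]
    simp only [inner_sub_left, inner_sub_right] at i1 i2 e ⊢
    linarith
  have i4 : ‖y' - y‖ = 0 := by nlinarith [norm_nonneg (y' - y)]
  exact sub_eq_zero.1 (norm_eq_zero.1 i4)

lemma eventually_sorts (s : EuclideanSpace ℝ (Fin n)) :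
    ∀ᶠ x in 𝓝 s, ∀ τ, Sorts τ x → Sorts τ s := by
  have h : ∀ᶠ x in 𝓝 s, ∀ i j, s i < s j → x i < x j := by
    refine eventually_all.2 fun i => eventually_all.2 fun j => ?_
    by_cases hij : s i < s j
    · have hi : Continuous fun x : EuclideanSpace ℝ (Fin n) => x i :=
        (EuclideanSpace.proj (𝕜 := ℝ) i).continuous
      have hj : Continuous fun x : EuclideanSpace ℝ (Fin n) => x j :=
        (EuclideanSpace.proj (𝕜 := ℝ) j).continuous
      filter_upwards [hi.continuousAt.eventually_lt hj.continuousAt hij] with x hx _ using hx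
    · exact Eventually.of_forall fun x h => absurd h hij
  filter_upwards [h] with x hx τ hτ k l hkl
  exact not_lt.1 fun hlt => absurd (hτ hkl) (not_le.2 (hx _ _ hlt))

lemma continuous_sortedShift (σ : Equiv.Perm (Fin n)) : Continuous (sortedShift σ) :=
  (LinearMap.continuous_of_finiteDimensional (σ.permMatrix ℝ).toEuclideanLin).sub continuous_const

/-- The proximal mapping in a neighbourhood of `s`, with a fixed permutation that sorts `s`. -/
lemma Sorts.eventually_prox_eq (hn : 2 ≤ n) {σ : Equiv.Perm (Fin n)}
    {s : EuclideanSpace ℝ (Fin n)} (hσ : Sorts σ s) :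
    ∀ᶠ x in 𝓝 s, prox (rankLoss n) x =
      (σ.permMatrix ℝ)ᵀ.toEuclideanLin (proj (monoCone n) (sortedShift σ x)) := by
  -- for every sorting permutation `τ` of `s`, the projection is constant on the ties of `s`
  have hτ : ∀ᶠ x in 𝓝 s, ∀ τ : Equiv.Perm (Fin n), Sorts τ s → ∀ k l, s (τ k) = s (τ l) →
      proj (monoCone n) (sortedShift τ x) k = proj (monoCone n) (sortedShift τ x) l := by
    refine eventually_all.2 fun τ => ?_
    by_cases hτ : Sorts τ s
    swap
    · exact Eventually.of_forall fun x h => absurd h hτ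
    have h : ∀ᶠ x in 𝓝 s, ∀ i : Fin (n - 1), s (τ ⟨i, by omega⟩) = s (τ ⟨i + 1, by omega⟩) →
        multiplier (sortedShift τ x) i < 0 := by
      refine eventually_all.2 fun i => ?_
      by_cases hi : s (τ ⟨i, by omega⟩) = s (τ ⟨i + 1, by omega⟩)
      -- Subtracting the strictly decreasing `rho n` turns the tie into a strict increase.
      · have h0 : multiplier (sortedShift τ s) i < 0 := by
          refine multiplier_neg_of_lt i ?_
          simp only [sortedShift, PiLp.sub_apply, permMatrix_apply, hi]
          linarith [rho_succ_lt hn i]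
        filter_upwards [(continuous_sortedShift τ).continuousAt.eventually
          (eventually_multiplier_neg h0)] with x hx _ using hx
      · exact Eventually.of_forall fun x h => absurd h hi
    filter_upwards [h] with x hx _ k l hkl
    refine eq_of_antitone_of_eq (a := fun k => s (τ k))
      (y := fun k => proj (monoCone n) (sortedShift τ x) k) hτ (fun i hi => ?_) hkl
    have hK := isKKT_activeSet (sortedShift τ x)
    have h0 := hK.active i (by_contra fun hne => (hx i hi).ne (hK.supported i hne))
    rw [diffMat_apply] at h0
    exact sub_eq_zero.1 h0
  filter_upwards [hτ, eventually_sorts s] with x hx hsort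
  obtain ⟨τ, hτx⟩ := exists_sorts x
  have hτs := hsort τ hτx
  -- Both permutations sort `s`, so `π` moves indices only within ties of `s`, where both
  -- projections are constant.
  set π : Equiv.Perm (Fin n) := σ.trans τ.symm with hπ
  have hστ : ∀ k, s (σ k) = s (τ k) := fun k =>
    congrFun (Tuple.unique_antitone (f := fun k => s k) hσ hτs) k
  have hlev : ∀ k, s (τ (π k)) = s (τ k) := fun k => by
    rw [hπ, Equiv.trans_apply, Equiv.apply_symm_apply, hστ]
  have e : (π.permMatrix ℝ).toEuclideanLin ((τ.permMatrix ℝ).toEuclideanLin x) =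
      (σ.permMatrix ℝ).toEuclideanLin x := by
    ext k
    simp only [permMatrix_apply, hπ, Equiv.trans_apply, Equiv.apply_symm_apply]
  have h1 : ∀ k, proj (monoCone n) (sortedShift τ x) (π k) =
      proj (monoCone n) (sortedShift τ x) k := fun k => hx τ hτs _ _ (hlev k)
  have h2 : ∀ k, proj (monoCone n) (sortedShift σ x) (π k) =
      proj (monoCone n) (sortedShift σ x) k := fun k => hx σ hσ _ _ (by
        rw [hστ, hστ]; exact hlev k)
  have h3 : proj (monoCone n) (sortedShift σ x) = proj (monoCone n) (sortedShift τ x) := by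
    have := proj_sub_eq_of_comp_perm (z := (τ.permMatrix ℝ).toEuclideanLin x) (r := rho n) h1
      (by rw [e]; exact h2)
    rwa [e] at this
  rw [hτx.prox_eq, h3]
  ext k
  rw [permMatrix_transpose_apply, permMatrix_transpose_apply, ← h1 (σ.symm k)]
  simp [hπ]

/-! ### The Bouligand subdifferential of the proximal mapping -/

/-- Sorting with a fixed permutation, shifting, projecting onto the monotone cone and restoring the
order. -/
def permProj (σ : Equiv.Perm (Fin n)) (x : EuclideanSpace ℝ (Fin n)) : EuclideanSpace ℝ (Fin n) :=
  (σ.permMatrix ℝ)ᵀ.toEuclideanLin (proj (monoCone n) (sortedShift σ x))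

lemma jacobianElement_eq (σ : Equiv.Perm (Fin n)) (K : Finset (Fin (n - 1))) :
    jacobianElement σ K = (σ.permMatrix ℝ)ᵀ * rowProj K * σ.permMatrix ℝ := by
  have h : (σ.permMatrix ℝ)ᵀ * σ.permMatrix ℝ = 1 := by
    apply Matrix.toEuclideanLin.injective
    ext x k
    rw [Matrix.toLpLin_mul_same, LinearMap.comp_apply, permMatrix_transpose_permMatrix]
    simp
  rw [jacobianElement, rowProj, Matrix.mul_sub, Matrix.sub_mul, Matrix.mul_one, h]
  simp only [Matrix.mul_assoc]

lemma jacobianElement_apply (σ : Equiv.Perm (Fin n)) (K : Finset (Fin (n - 1)))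
    (x : EuclideanSpace ℝ (Fin n)) : (jacobianElement σ K).toEuclideanLin x =
      (σ.permMatrix ℝ)ᵀ.toEuclideanLin
        ((rowProj K).toEuclideanLin ((σ.permMatrix ℝ).toEuclideanLin x)) := by
  rw [jacobianElement_eq, Matrix.toLpLin_mul_same, Matrix.toLpLin_mul_same]
  rfl

lemma sortedShift_add (σ : Equiv.Perm (Fin n)) (x h : EuclideanSpace ℝ (Fin n)) :
    sortedShift σ (x + h) = sortedShift σ x + (σ.permMatrix ℝ).toEuclideanLin h := by
  rw [sortedShift, sortedShift, map_add]
  abel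

/-- On the cone of a common index set the map is affine with linear part `jacobianElement σ K`. -/
lemma permProj_add {σ : Equiv.Perm (Fin n)} {K : Finset (Fin (n - 1))}
    {x h : EuclideanSpace ℝ (Fin n)} (hx : K ∈ indexSets (sortedShift σ x))
    (hh : K ∈ indexSets (sortedShift σ (x + h))) :
    permProj σ (x + h) = permProj σ x + (jacobianElement σ K).toEuclideanLin h := by
  rw [permProj, permProj, proj_eq_rowProj hx, proj_eq_rowProj hh, sortedShift_add, map_add, map_add,
    jacobianElement_apply]

lemma norm_permProj_sub_le (σ : Equiv.Perm (Fin n)) (x y : EuclideanSpace ℝ (Fin n)) :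
    ‖permProj σ x - permProj σ y‖ ≤ ‖x - y‖ := by
  rw [permProj, permProj, ← map_sub, norm_permMatrix_transpose]
  refine (norm_proj_sub_proj_le _ _).trans ?_
  rw [sortedShift, sortedShift, sub_sub_sub_cancel_right, ← map_sub, norm_permMatrix]

lemma eventually_indexSets_sortedShift_subset (σ : Equiv.Perm (Fin n))
    (x : EuclideanSpace ℝ (Fin n)) :
    ∀ᶠ y in 𝓝 x, indexSets (sortedShift σ y) ⊆ indexSets (sortedShift σ x) :=
  (continuous_sortedShift σ).continuousAt.eventually (eventually_indexSets_subset _)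

lemma jacobianSet_finite (σ : Equiv.Perm (Fin n)) (x : EuclideanSpace ℝ (Fin n)) :
    (jacobianSet σ x).Finite :=
  (Set.finite_range (jacobianElement σ)).subset fun _ ⟨K, _, hK⟩ => ⟨K, hK.symm⟩

lemma jacobianSet_mono {σ : Equiv.Perm (Fin n)} {x y : EuclideanSpace ℝ (Fin n)}
    (h : indexSets (sortedShift σ y) ⊆ indexSets (sortedShift σ x)) :
    jacobianSet σ y ⊆ jacobianSet σ x :=
  fun _ ⟨K, hK, e⟩ => ⟨K, h hK, e⟩

lemma HasFDerivAt.jacobian_eq {m : ℕ} {F : EuclideanSpace ℝ (Fin n) → EuclideanSpace ℝ (Fin m)}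
    {x : EuclideanSpace ℝ (Fin n)} {A : Matrix (Fin m) (Fin n) ℝ}
    (h : HasFDerivAt F (LinearMap.toContinuousLinearMap A.toEuclideanLin) x) :
    jacobian F x = A := by
  ext i j
  rw [jacobian, Matrix.of_apply, h.fderiv]
  simp [Matrix.toLpLin_apply]

section Local

variable {F : EuclideanSpace ℝ (Fin n) → EuclideanSpace ℝ (Fin n)} {σ : Equiv.Perm (Fin n)}
  {x : EuclideanSpace ℝ (Fin n)} {K : Finset (Fin (n - 1))}

lemma hasFDerivAt_of_indexSets_eq_singleton (hF : F =ᶠ[𝓝 x] permProj σ)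
    (hK : indexSets (sortedShift σ x) = {K}) :
    HasFDerivAt F (LinearMap.toContinuousLinearMap (jacobianElement σ K).toEuclideanLin) x := by
  have hx : K ∈ indexSets (sortedShift σ x) := by rw [hK]; rfl
  have h1 : F =ᶠ[𝓝 x] fun y => (permProj σ x - (jacobianElement σ K).toEuclideanLin x) +
      LinearMap.toContinuousLinearMap (jacobianElement σ K).toEuclideanLin y := by
    filter_upwards [hF, eventually_indexSets_sortedShift_subset σ x] with y hy hsub
    obtain ⟨K', hK'⟩ := indexSets_nonempty (sortedShift σ y)
    obtain rfl : K' = K := by have := hsub hK'; rwa [hK] at this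
    have e : y = x + (y - x) := by abel
    rw [hy, e, permProj_add hx (by rwa [← e]), LinearMap.coe_toContinuousLinearMap', map_add]
    abel
  exact ((ContinuousLinearMap.hasFDerivAt _).const_add _).congr_of_eventuallyEq h1

/-- For a direction in the cone of `K` the ray from `x` stays in that cone, so the difference
quotient is constant for small positive `t`. -/
lemma fderiv_apply_of_mem_indexSets (hF : F =ᶠ[𝓝 x] permProj σ) (hd : DifferentiableAt ℝ F x)
    (hK : K ∈ indexSets (sortedShift σ x)) {h : EuclideanSpace ℝ (Fin n)}
    (hh : K ∈ indexSets ((σ.permMatrix ℝ).toEuclideanLin h)) :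
    fderiv ℝ F x h = (jacobianElement σ K).toEuclideanLin h := by
  have hlim : Tendsto (fun t : ℝ => t⁻¹ • (F (x + t • h) - F x)) (𝓝[>] 0) (𝓝 (fderiv ℝ F x h)) := by
    have := (hd.hasFDerivAt.hasLineDerivAt h).tendsto_slope_zero_right
    simpa using this
  refine tendsto_nhds_unique hlim (tendsto_const_nhds.congr' ?_)
  have hc : Tendsto (fun t : ℝ => x + t • h) (𝓝[>] 0) (𝓝 x) := by
    have : ContinuousAt (fun t : ℝ => x + t • h) 0 := by fun_prop
    have h0 := this.tendsto
    rw [zero_smul, add_zero] at h0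
    exact h0.mono_left nhdsWithin_le_nhds
  filter_upwards [hc.eventually hF, self_mem_nhdsWithin] with t ht ht0
  have ht0 : 0 < t := ht0
  rw [ht, hF.eq_of_nhds, permProj_add hK, add_sub_cancel_left, map_smul, smul_smul,
    inv_mul_cancel₀ ht0.ne', one_smul]
  rw [sortedShift_add, map_smul]
  exact add_mem_indexSets hK (smul_mem_indexSets hh ht0.le)

lemma jacobian_eq_of_mem_indexSets (hF : F =ᶠ[𝓝 x] permProj σ) (hd : DifferentiableAt ℝ F x)
    (hK : K ∈ indexSets (sortedShift σ x)) : jacobian F x = jacobianElement σ K := by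
  obtain ⟨d, -, hdir⟩ := exists_interior_direction K
  have hd0 : K ∈ indexSets d := by
    obtain ⟨ε, -, h⟩ := hdir 0
    simpa using h
  have h : fderiv ℝ F x = LinearMap.toContinuousLinearMap (jacobianElement σ K).toEuclideanLin := by
    ext1 e
    -- The cone has interior: both `d` and `d + ε e` lie in it, so linearity extends the agreement
    -- to every `e`.
    obtain ⟨ε, hε, he⟩ := hdir ((σ.permMatrix ℝ).toEuclideanLin e)
    have h1 := fderiv_apply_of_mem_indexSets hF hd hK
      (h := (σ.permMatrix ℝ)ᵀ.toEuclideanLin d) (by rwa [permMatrix_permMatrix_transpose])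
    have h2 := fderiv_apply_of_mem_indexSets hF hd hK
      (h := (σ.permMatrix ℝ)ᵀ.toEuclideanLin d + ε • e)
      (by rwa [map_add, permMatrix_permMatrix_transpose, map_smul])
    rw [map_add, map_add, h1, map_smul, map_smul] at h2
    exact smul_right_injective _ hε.ne' (add_left_cancel h2)
  exact HasFDerivAt.jacobian_eq (h ▸ hd.hasFDerivAt)

/-- The Bouligand subdifferential of a map that agrees locally with `permProj σ`. -/
lemma bouligand_eq_jacobianSet (hF : F =ᶠ[𝓝 x] permProj σ) :
    bouligand F x = jacobianSet σ x := by
  have hF' := eventually_eventually_nhds.2 hF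
  ext V
  constructor
  · rintro ⟨u, hd, hu, hV⟩
    -- Near `x` the Jacobians take values in a finite, hence closed, set.
    refine (jacobianSet_finite σ x).isClosed.mem_of_tendsto hV ?_
    filter_upwards [hu.eventually hF',
      hu.eventually (eventually_indexSets_sortedShift_subset σ x)] with k hk hsub
    obtain ⟨K, hK⟩ := indexSets_nonempty (sortedShift σ (u k))
    exact ⟨K, hsub hK, jacobian_eq_of_mem_indexSets hk (hd k) hK⟩
  · rintro ⟨K, hK, rfl⟩
    -- Approach `x` through the interior of the cone of `K`, where `K` is the only index set and the
    -- map is differentiable.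
    obtain ⟨d, hd, -⟩ := exists_interior_direction K
    set u : ℕ → EuclideanSpace ℝ (Fin n) := fun k =>
      x + (1 / ((k : ℝ) + 1)) • (σ.permMatrix ℝ)ᵀ.toEuclideanLin d with hu_def
    have hu : Tendsto u atTop (𝓝 x) := by
      have := (tendsto_one_div_add_atTop_nhds_zero_nat (𝕜 := ℝ)).smul_const
        ((σ.permMatrix ℝ)ᵀ.toEuclideanLin d)
      have h := this.const_add x
      rwa [zero_smul, add_zero] at h
    have hK' : ∀ k, indexSets (sortedShift σ (u k)) = {K} := fun k => by
      rw [hu_def, sortedShift_add, map_smul, permMatrix_permMatrix_transpose]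
      exact hd _ hK _ (by positivity)
    obtain ⟨N, hN⟩ := eventually_atTop.1 (hu.eventually hF')
    have hder := fun k => hasFDerivAt_of_indexSets_eq_singleton (hN (k + N) (by omega))
      (hK' (k + N))
    exact ⟨fun k => u (k + N), fun k => (hder k).differentiableAt,
      hu.comp (tendsto_add_atTop_nat N),
      tendsto_const_nhds.congr fun k => (HasFDerivAt.jacobian_eq (hder k)).symm⟩

end Local

/-! ### Strong semismoothness -/

section Semismooth

lemma exists_prox_eventuallyEq (hn : 2 ≤ n) (x : EuclideanSpace ℝ (Fin n)) :
    ∃ σ, prox (rankLoss n) =ᶠ[𝓝 x] permProj σ :=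
  let ⟨σ, hσ⟩ := exists_sorts x
  ⟨σ, hσ.eventually_prox_eq hn⟩

lemma locallyLipschitz_prox (hn : 2 ≤ n) : LocallyLipschitz (prox (rankLoss n)) := by
  intro x
  obtain ⟨σ, hσ⟩ := exists_prox_eventuallyEq hn x
  refine ⟨1, _, hσ, LipschitzOnWith.of_dist_le_mul fun y hy z hz => ?_⟩
  have hy : prox (rankLoss n) y = permProj σ y := hy
  have hz : prox (rankLoss n) z = permProj σ z := hz
  simpa [dist_eq_norm, hy, hz] using norm_permProj_sub_le σ y z

lemma finite_bouligand_prox (hn : 2 ≤ n) (x : EuclideanSpace ℝ (Fin n)) :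
    (bouligand (prox (rankLoss n)) x).Finite := by
  obtain ⟨σ, hσ⟩ := exists_prox_eventuallyEq hn x
  rw [bouligand_eq_jacobianSet hσ]
  exact jacobianSet_finite σ x

lemma bouligand_prox_nonempty (hn : 2 ≤ n) (x : EuclideanSpace ℝ (Fin n)) :
    (bouligand (prox (rankLoss n)) x).Nonempty := by
  obtain ⟨σ, hσ⟩ := exists_prox_eventuallyEq hn x
  rw [bouligand_eq_jacobianSet hσ]
  obtain ⟨K, hK⟩ := indexSets_nonempty (sortedShift σ x)
  exact ⟨_, K, hK, rfl⟩

lemma eventually_bouligand_prox_subset (hn : 2 ≤ n) (x : EuclideanSpace ℝ (Fin n)) :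
    ∀ᶠ y in 𝓝 x, bouligand (prox (rankLoss n)) y ⊆ bouligand (prox (rankLoss n)) x := by
  obtain ⟨σ, hσ⟩ := exists_prox_eventuallyEq hn x
  filter_upwards [eventually_eventually_nhds.2 hσ, eventually_indexSets_sortedShift_subset σ x]
    with y hy hsub
  rw [bouligand_eq_jacobianSet hσ, bouligand_eq_jacobianSet hy]
  exact jacobianSet_mono hsub

/-- Elements of the Bouligand subdifferential reproduce increments of the proximal mapping
exactly. -/
lemma eventually_bouligand_prox_apply (hn : 2 ≤ n) (x : EuclideanSpace ℝ (Fin n)) :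
    ∀ᶠ h in 𝓝 (0 : EuclideanSpace ℝ (Fin n)), ∀ V ∈ bouligand (prox (rankLoss n)) (x + h),
      V.toEuclideanLin h = prox (rankLoss n) (x + h) - prox (rankLoss n) x := by
  obtain ⟨σ, hσ⟩ := exists_prox_eventuallyEq hn x
  have hc : Tendsto (fun h => x + h) (𝓝 (0 : EuclideanSpace ℝ (Fin n))) (𝓝 x) := by
    have : ContinuousAt (fun h => x + h) (0 : EuclideanSpace ℝ (Fin n)) := by fun_prop
    simpa using this.tendsto
  filter_upwards [hc.eventually (eventually_eventually_nhds.2 hσ),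
    hc.eventually (eventually_indexSets_sortedShift_subset σ x)] with h hh hsub V hV
  rw [bouligand_eq_jacobianSet hh] at hV
  obtain ⟨K, hK, rfl⟩ := hV
  rw [hσ.eq_of_nhds, Eventually.self_of_nhds hh, permProj_add (hsub hK) hK, add_sub_cancel_left]

/-- An index set at a close point of the ray is also one at `x`; convexity of its cone covers the
segment between, so the difference quotient is eventually constant. -/
lemma exists_directional_derivative_prox (hn : 2 ≤ n) (x d : EuclideanSpace ℝ (Fin n)) :
    ∃ l, Tendsto (fun t : ℝ => t⁻¹ • (prox (rankLoss n) (x + t • d) - prox (rankLoss n) x))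
      (𝓝[>] 0) (𝓝 l) := by
  obtain ⟨σ, hσ⟩ := exists_prox_eventuallyEq hn x
  have hc : Tendsto (fun t : ℝ => x + t • d) (𝓝[>] 0) (𝓝 x) := by
    have : ContinuousAt (fun t : ℝ => x + t • d) 0 := by fun_prop
    have h0 := this.tendsto
    rw [zero_smul, add_zero] at h0
    exact h0.mono_left nhdsWithin_le_nhds
  obtain ⟨t₀, hsub, ht₀⟩ := ((hc.eventually (eventually_indexSets_sortedShift_subset σ x)).and
    self_mem_nhdsWithin).exists
  have ht₀ : 0 < t₀ := ht₀
  obtain ⟨K, hK⟩ := indexSets_nonempty (sortedShift σ (x + t₀ • d))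
  have hKx := hsub hK
  refine ⟨(jacobianElement σ K).toEuclideanLin d, tendsto_const_nhds.congr' ?_⟩
  filter_upwards [hc.eventually hσ, self_mem_nhdsWithin,
    nhdsWithin_le_nhds (Iio_mem_nhds ht₀)] with t ht htp htl
  have htp : 0 < t := htp
  have htl : t < t₀ := htl
  have hKt : K ∈ indexSets (sortedShift σ (x + t • d)) := by
    have e : sortedShift σ (x + t • d) = (1 - t / t₀) • sortedShift σ x +
        (t / t₀) • sortedShift σ (x + t₀ • d) := by
      rw [sortedShift_add, sortedShift_add, map_smul, map_smul, smul_add, smul_smul,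
        div_mul_cancel₀ _ ht₀.ne']
      module
    rw [e]
    refine add_mem_indexSets (smul_mem_indexSets hKx (sub_nonneg.2 ?_))
      (smul_mem_indexSets hK (by positivity))
    exact (div_le_one ht₀).2 htl.le
  rw [ht, hσ.eq_of_nhds, permProj_add hKx hKt, add_sub_cancel_left, map_smul, smul_smul,
    inv_mul_cancel₀ htp.ne', one_smul]

lemma isStronglySemismooth_bouligand_prox (hn : 2 ≤ n) :
    IsStronglySemismooth (prox (rankLoss n)) (bouligand (prox (rankLoss n))) where
  locallyLipschitz := locallyLipschitz_prox hn
  nonempty := bouligand_prox_nonempty hn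
  compact x := (finite_bouligand_prox hn x).isCompact
  upperSemicontinuous x t ht := by
    filter_upwards [eventually_bouligand_prox_subset hn x] with y hy using nhdsSet_mono hy ht
  directionallyDifferentiable := exists_directional_derivative_prox hn
  quadratic_estimate x := by
    refine ⟨0, ?_⟩
    filter_upwards [eventually_bouligand_prox_apply hn x] with h hh V hV
    rw [hh V hV]
    simp

lemma isStronglySemismooth_clarke_prox (hn : 2 ≤ n) :
    IsStronglySemismooth (prox (rankLoss n)) (clarke (prox (rankLoss n))) where
  locallyLipschitz := locallyLipschitz_prox hn
  nonempty x := (bouligand_prox_nonempty hn x).convexHull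
  compact x := (finite_bouligand_prox hn x).isCompact_convexHull ℝ
  upperSemicontinuous x t ht := by
    filter_upwards [eventually_bouligand_prox_subset hn x] with y hy
    exact nhdsSet_mono (convexHull_mono hy) ht
  directionallyDifferentiable := exists_directional_derivative_prox hn
  quadratic_estimate x := by
    refine ⟨0, ?_⟩
    filter_upwards [eventually_bouligand_prox_apply hn x] with h hh V hV
    -- The exact increment identity is affine in `V`, so it passes to the convex hull.
    have hconv : Convex ℝ {V : Matrix (Fin n) (Fin n) ℝ | V.toEuclideanLin h =
        prox (rankLoss n) (x + h) - prox (rankLoss n) x} := by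
      intro A hA B hB a b _ _ hab
      have hA : A.toEuclideanLin h = _ := hA
      have hB : B.toEuclideanLin h = _ := hB
      change (a • A + b • B).toEuclideanLin h = _
      rw [map_add, map_smul, map_smul, LinearMap.add_apply, LinearMap.smul_apply,
        LinearMap.smul_apply, hA, hB, ← add_smul, hab, one_smul]
    have hV' : V.toEuclideanLin h = prox (rankLoss n) (x + h) - prox (rankLoss n) x :=
      convexHull_min hh hconv hV
    rw [hV']
    simp

end Semismooth

/-! ### Lists of constant blocks -/

lemma exists_runs {α : Type*} (l : List α) :
    ∃ (N : ℕ) (len : Fin N → ℕ) (v : Fin N → α), (∀ t, 0 < len t) ∧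
      l = (List.ofFn fun t => List.replicate (len t) (v t)).flatten ∧
      ∀ t u : Fin N, (u : ℕ) = (t : ℕ) + 1 → v t ≠ v u := by
  induction l with
  | nil => exact ⟨0, Fin.elim0, Fin.elim0, fun t => t.elim0, by simp, fun t => t.elim0⟩
  | cons a l ih =>
    obtain ⟨N, len, v, hpos, hl, halt⟩ := ih
    cases N with
    | zero =>
      refine ⟨1, fun _ => 1, fun _ => a, fun _ => one_pos, ?_, fun t u h => by omega⟩
      simpa using hl
    | succ N =>
      by_cases ha : a = v 0
      · refine ⟨N + 1, Fin.cons (len 0 + 1) (Fin.tail len), v, fun t => ?_, ?_, halt⟩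
        · refine Fin.cases ?_ (fun u => ?_) t
          · simp
          · simpa [Fin.tail] using hpos u.succ
        · rw [hl]
          simp [List.ofFn_succ, List.replicate_succ, Fin.tail, ha]
      · refine ⟨N + 2, Fin.cons 1 len, Fin.cons a v, fun t => ?_, ?_, fun t u htu => ?_⟩
        · refine Fin.cases ?_ (fun u => ?_) t
          · simp
          · simpa using hpos u
        · rw [hl, List.ofFn_succ (n := N + 1)]
          simp
        · induction u using Fin.cases with
          | zero => simp at htu
          | succ u =>
            induction t using Fin.cases with
            | zero =>
              obtain rfl : u = 0 := by
                apply Fin.ext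
                simpa using htu
              simpa using ha
            | succ t =>
              simpa using halt t u (by simpa using htu)

lemma exists_isBlockDecomposition {m : ℕ} (θ : Fin m → ℝ) (hθ : ∀ i, θ i = 0 ∨ θ i = 1) :
    ∃ (N : ℕ) (len : Fin N → ℕ) (J : Finset (Fin N)), IsBlockDecomposition θ len J := by
  obtain ⟨N, len, v, hpos, hl, halt⟩ := exists_runs (List.ofFn θ)
  have hv : ∀ t, v t = 0 ∨ v t = 1 := fun t => by
    have h : v t ∈ List.ofFn θ := by
      rw [hl, List.mem_flatten]
      exact ⟨_, List.mem_ofFn.2 ⟨t, rfl⟩, List.mem_replicate.2 ⟨(hpos t).ne', rfl⟩⟩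
    obtain ⟨i, hi⟩ := List.mem_ofFn.1 h
    exact hi ▸ hθ i
  classical
  refine ⟨N, len, Finset.univ.filter fun t => v t = 1, hpos, ?_, fun t u htu => ?_⟩
  · rw [hl]
    congr 2
    funext t
    congr 1
    rcases hv t with h | h <;> simp [h]
  · have := halt t u htu
    rcases hv t with h | h <;> rcases hv u with h' | h' <;> simp_all

/-- `B` lists the block boundaries; this replaces a concatenation by a function constant between
consecutive boundaries. -/
lemma flatten_ofFn_replicate {α : Type*} {N : ℕ} (L : Fin N → ℕ) (v : Fin N → α) (B : ℕ → ℕ)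
    (hB0 : B 0 = 0) (hB : ∀ t : Fin N, B (t + 1) = B t + L t) (f : ℕ → α)
    (hf : ∀ (t : Fin N) (i : ℕ), B t ≤ i → i < B (t + 1) → f i = v t) :
    (List.ofFn fun t => List.replicate (L t) (v t)).flatten = (List.range (B N)).map f := by
  induction N with
  | zero => simp [hB0]
  | succ N ih =>
    have hlast := hB (Fin.last N)
    have hflast := hf (Fin.last N)
    rw [Fin.val_last] at hlast hflast
    rw [List.ofFn_succ', List.concat_eq_append, List.flatten_append,
      ih (fun t => L t.castSucc) (fun t => v t.castSucc) (fun t => hB t.castSucc)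
        (fun t => hf t.castSucc), hlast, List.range_add, List.map_append, List.map_map]
    congr 1
    rw [List.flatten_singleton]
    refine (List.eq_replicate_iff.2 ⟨by simp, fun b hb => ?_⟩).symm
    obtain ⟨i, hi, rfl⟩ := List.mem_map.1 hb
    have := List.mem_range.1 hi
    exact hflast (B N + i) (by omega) (by omega)

/-- The total length of the blocks before the `k`-th. -/
def blockStart {N : ℕ} (len : Fin N → ℕ) (k : ℕ) : ℕ :=
  ∑ u ∈ Finset.univ.filter (fun u : Fin N => (u : ℕ) < k), len u

section Blocks

variable {N : ℕ} (len : Fin N → ℕ)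

lemma blockStart_zero : blockStart len 0 = 0 := by simp [blockStart]

lemma sum_Iio_eq_blockStart (t : Fin N) : ∑ u ∈ Finset.Iio t, len u = blockStart len t := by
  rw [blockStart]
  congr 1
  ext u
  simp only [Finset.mem_Iio, Finset.mem_filter, Finset.mem_univ, true_and, Fin.lt_def]

lemma sum_Iic_eq_blockStart (t : Fin N) : ∑ u ∈ Finset.Iic t, len u = blockStart len (t + 1) := by
  rw [blockStart]
  congr 1
  ext u
  simp only [Finset.mem_Iic, Finset.mem_filter, Finset.mem_univ, true_and, Fin.le_def,
    Nat.lt_succ_iff]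

lemma blockStart_succ (t : Fin N) : blockStart len (t + 1) = blockStart len t + len t := by
  rw [← sum_Iic_eq_blockStart, ← sum_Iio_eq_blockStart, ← Finset.Iio_insert,
    Finset.sum_insert (by simp), add_comm]

lemma blockStart_mono : Monotone (blockStart len) := fun _ _ h =>
  Finset.sum_le_sum_of_subset fun _ hu => by
    simp only [Finset.mem_filter, Finset.mem_univ, true_and] at hu ⊢
    omega

end Blocks

section Decomposition

variable {m N : ℕ} {θ : Fin m → ℝ} {len : Fin N → ℕ} {J : Finset (Fin N)}

open Classical in
lemma IsBlockDecomposition.ofFn_eq (h : IsBlockDecomposition θ len J) :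
    List.ofFn θ = (List.range (blockStart len N)).map fun i =>
      if ∃ t ∈ J, blockStart len t ≤ i ∧ i < blockStart len (t + 1) then (1 : ℝ) else 0 := by
  rw [h.concat]
  refine flatten_ofFn_replicate _ _ _ (blockStart_zero len) (blockStart_succ len) _
    fun t i hi hi' => ?_
  by_cases ht : t ∈ J
  · rw [if_pos ht, if_pos ⟨t, ht, hi, hi'⟩]
  · rw [if_neg ht, if_neg]
    rintro ⟨u, hu, h1, h2⟩
    rcases lt_trichotomy u t with hut | rfl | hut
    · have := blockStart_mono len (show (u : ℕ) + 1 ≤ t from hut)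
      omega
    · exact ht hu
    · have := blockStart_mono len (show (t : ℕ) + 1 ≤ u from hut)
      omega

lemma IsBlockDecomposition.blockStart_eq (h : IsBlockDecomposition θ len J) :
    blockStart len N = m := by
  simpa using (congrArg List.length h.ofFn_eq).symm

lemma IsBlockDecomposition.eq_one_iff (h : IsBlockDecomposition θ len J) (i : Fin m) :
    θ i = 1 ↔ ∃ t ∈ J, blockStart len t ≤ i ∧ (i : ℕ) < blockStart len (t + 1) := by
  classical
  have e : θ i = if ∃ t ∈ J, blockStart len t ≤ i ∧ (i : ℕ) < blockStart len (t + 1)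
      then (1 : ℝ) else 0 := by
    have h1 : (List.ofFn θ)[(i : ℕ)]'(by simp) = θ i := by simp
    rw [← h1]
    simp only [h.ofFn_eq, List.getElem_map, List.getElem_range]
  rw [e]
  split_ifs with hc <;> simp [hc]

/-- The closed row intervals of distinct blocks of ones are separated. -/
lemma IsBlockDecomposition.blockStart_lt (h : IsBlockDecomposition θ len J) {t u : Fin N}
    (ht : t ∈ J) (hu : u ∈ J) (htu : t < u) : blockStart len (t + 1) < blockStart len u := by
  have hlt : (t : ℕ) + 1 < u := by
    refine lt_of_le_of_ne htu fun e => ?_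
    exact (h.alternate t u e.symm).1 ht hu
  have h1 := blockStart_succ len ⟨t + 1, by omega⟩
  have h2 := h.len_pos ⟨t + 1, by omega⟩
  have h3 := blockStart_mono len (show (t : ℕ) + 1 + 1 ≤ u from hlt)
  simp only at h1
  omega

lemma IsBlockDecomposition.eq_of_mem (h : IsBlockDecomposition θ len J) {t u : Fin N}
    (ht : t ∈ J) (hu : u ∈ J) {l : ℕ} (h1 : blockStart len t ≤ l) (h2 : l ≤ blockStart len (t + 1))
    (h3 : blockStart len u ≤ l) (h4 : l ≤ blockStart len (u + 1)) : t = u := by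
  rcases lt_trichotomy t u with htu | htu | htu
  · have := h.blockStart_lt ht hu htu
    omega
  · exact htu
  · have := h.blockStart_lt hu ht htu
    omega

open Classical in
lemma IsBlockDecomposition.thetaList_eq (h : IsBlockDecomposition θ len J) (hm : 0 < m) :
    thetaList len J = (List.range (m + 1)).map fun l =>
      if ∃ t ∈ J, blockStart len t ≤ l ∧ l ≤ blockStart len (t + 1) then (0 : ℝ) else 1 := by
  have hN : N ≠ 0 := by
    rintro rfl
    have h1 := h.blockStart_eq
    rw [blockStart_zero] at h1
    omega
  set L : Fin N → ℕ := fun t => if t ∈ J then len t + 1 else if N = 1 then len t + 1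
    else if (t : ℕ) = 0 ∨ (t : ℕ) + 1 = N then len t else len t - 1 with hL
  -- A run of `len t` active differences ties `len t + 1` rows, including both end rows. A block of
  -- ones thus starts at its offset, and a later block of zeros one row further on.
  set B : ℕ → ℕ := fun k => if k = 0 ∨ ∃ hk : k < N, (⟨k, hk⟩ : Fin N) ∈ J then blockStart len k
    else blockStart len k + 1 with hB
  have hblock : thetaBlock len J = fun t => List.replicate (L t) (if t ∈ J then (0 : ℝ) else 1) := by
    funext t
    rw [thetaBlock]
    simp only [hL]
    split_ifs <;> rfl
  have hBpos : ∀ t ∈ J, B t = blockStart len t := fun t ht => if_pos (Or.inr ⟨t.2, ht⟩)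
  have hBsucc : ∀ t ∈ J, B (t + 1) = blockStart len (t + 1) + 1 := fun t ht => by
    refine if_neg ?_
    rintro (h0 | ⟨hk, hk'⟩)
    · omega
    · exact (h.alternate t ⟨t + 1, hk⟩ rfl).1 ht hk'
  have hBneg : ∀ t, t ∉ J → (t : ℕ) ≠ 0 → B t = blockStart len t + 1 := fun t ht h0 => by
    refine if_neg ?_
    rintro (h0' | ⟨hk, hk'⟩)
    · exact h0 h0'
    · exact ht hk'
  have hBneg_succ : ∀ t, t ∉ J → (t : ℕ) + 1 < N → B (t + 1) = blockStart len (t + 1) :=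
    fun t ht hlt => if_pos (Or.inr ⟨hlt, by
      by_contra hn
      exact ht ((h.alternate t ⟨t + 1, hlt⟩ rfl).2 hn)⟩)
  have hBN : B N = blockStart len N + 1 := by
    refine if_neg ?_
    rintro (h0 | ⟨hk, -⟩)
    · exact hN h0
    · omega
  have hB0 : B 0 = 0 := by simp [hB, blockStart_zero]
  have e : B N = m + 1 := by rw [hBN, h.blockStart_eq]
  rw [thetaList, hblock, ← e]
  refine flatten_ofFn_replicate L _ B hB0 (fun t => ?_) _ fun t l hl hl' => ?_
  · have h1 := blockStart_succ len t
    have h2 := h.len_pos t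
    by_cases ht : t ∈ J
    · rw [hBpos t ht, hBsucc t ht, h1]
      simp only [hL, if_pos ht]
      omega
    · have h3 : B t = if (t : ℕ) = 0 then 0 else blockStart len t + 1 := by
        split_ifs with h0
        · rw [h0, hB0]
        · exact hBneg t ht h0
      have h4 : B (t + 1) = if (t : ℕ) + 1 = N then blockStart len (t + 1) + 1
          else blockStart len (t + 1) := by
        split_ifs with h0
        · rw [h0, hBN]
        · exact hBneg_succ t ht (by omega)
      -- Positivity of `len t` keeps the truncated subtraction `len t - 1` exact.
      have h5 : (t : ℕ) = 0 → blockStart len t = 0 := fun h0 => by rw [h0, blockStart_zero]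
      rw [h3, h4, h1]
      simp only [hL, if_neg ht]
      split_ifs <;> omega
  · by_cases ht : t ∈ J
    · rw [hBpos t ht] at hl
      rw [hBsucc t ht] at hl'
      rw [if_pos ht, if_pos ⟨t, ht, hl, by omega⟩]
    · rw [if_neg ht, if_neg]
      rintro ⟨u, hu, h1, h2⟩
      rcases lt_trichotomy u t with hut | rfl | hut
      · have h3 := blockStart_mono len (show (u : ℕ) + 1 ≤ t from hut)
        rw [hBneg t ht (by have : (u : ℕ) < t := hut; omega)] at hl
        omega
      · exact ht hu
      · have h3 := blockStart_mono len (show (t : ℕ) + 1 ≤ u from hut)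
        rw [hBneg_succ t ht (by have : (t : ℕ) < u := hut; omega)] at hl'
        omega

end Decomposition

/-! ### The distinguished element -/

section Distinguished

variable {N : ℕ} {θ : Fin (n - 1) → ℝ} {len : Fin N → ℕ} {J : Finset (Fin N)}

lemma gammaMat_apply (l : Fin n) (j : Fin J.card) :
    gammaMat n len J l j = if blockStart len (J.orderEmbOfFin rfl j) ≤ l ∧
      (l : ℕ) ≤ blockStart len (J.orderEmbOfFin rfl j + 1) then
        1 / √((len (J.orderEmbOfFin rfl j) : ℝ) + 1) else 0 := by
  simp only [gammaMat, Matrix.of_apply, sum_Iio_eq_blockStart, sum_Iic_eq_blockStart]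

/-- The diagonal of `0`s and `1`s plus the averaging operators of the blocks of ones. -/
def blockAveraging (θs : Fin n → ℝ) (len : Fin N → ℕ) (J : Finset (Fin N)) :
    Matrix (Fin n) (Fin n) ℝ :=
  Matrix.diagonal θs + gammaMat n len J * (gammaMat n len J)ᵀ

lemma blockAveraging_transpose (θs : Fin n → ℝ) :
    (blockAveraging θs len J)ᵀ = blockAveraging θs len J := by
  simp [blockAveraging, Matrix.transpose_add, Matrix.transpose_mul]

lemma gammaMat_eq_of_mem (h : IsBlockDecomposition θ len J) {t : Fin N} (ht : t ∈ J) {l l' : Fin n}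
    (h1 : blockStart len t ≤ l) (h2 : (l : ℕ) ≤ blockStart len (t + 1))
    (h1' : blockStart len t ≤ l') (h2' : (l' : ℕ) ≤ blockStart len (t + 1)) (j : Fin J.card) :
    gammaMat n len J l j = gammaMat n len J l' j := by
  rw [gammaMat_apply, gammaMat_apply]
  congr 1
  have hj : J.orderEmbOfFin rfl j ∈ J := J.orderEmbOfFin_mem rfl j
  refine propext ⟨fun hc => ?_, fun hc => ?_⟩
  · rw [← h.eq_of_mem ht hj h1 h2 hc.1 hc.2]
    exact ⟨h1', h2'⟩
  · rw [← h.eq_of_mem ht hj h1' h2' hc.1 hc.2]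
    exact ⟨h1, h2⟩

lemma diffRows_mul_blockAveraging (h : IsBlockDecomposition θ len J) {K : Finset (Fin (n - 1))}
    (hK : ∀ i, i ∈ K ↔ θ i = 1) {θs : Fin n → ℝ}
    (hθs : ∀ l : Fin n, ∀ t ∈ J, blockStart len t ≤ l → (l : ℕ) ≤ blockStart len (t + 1) →
      θs l = 0) :
    diffRows K * blockAveraging θs len J = 0 := by
  ext ⟨i, hi⟩ k
  have e : (diffRows K * blockAveraging θs len J) ⟨i, hi⟩ k =
      (diffMat n).toEuclideanLin (WithLp.toLp 2 fun l => blockAveraging θs len J l k) i := by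
    rw [Matrix.toLpLin_apply]
    rfl
  obtain ⟨t, ht, h1, h2⟩ := (h.eq_one_iff i).1 ((hK i).1 hi)
  rw [e, diffMat_apply, Matrix.zero_apply, sub_eq_zero]
  simp only [blockAveraging, Matrix.add_apply, Matrix.mul_apply, Matrix.diagonal_apply]
  have h1' : blockStart len t ≤ (i : ℕ) + 1 := by omega
  rw [hθs ⟨i, by omega⟩ t ht h1 h2.le, hθs ⟨i + 1, by omega⟩ t ht h1' h2, ite_self, ite_self]
  congr 1
  refine Finset.sum_congr rfl fun j _ => ?_
  rw [gammaMat_eq_of_mem h ht (l := ⟨i, by omega⟩) (l' := ⟨i + 1, by omega⟩) h1 h2.le h1' h2]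

lemma eq_of_mem_block (h : IsBlockDecomposition θ len J) {t : Fin N} (ht : t ∈ J)
    {y : EuclideanSpace ℝ (Fin n)} (hy : ∀ i, θ i = 1 → (diffMat n).toEuclideanLin y i = 0)
    {l l' : Fin n} (h1 : blockStart len t ≤ l) (h2 : (l : ℕ) ≤ blockStart len (t + 1))
    (h1' : blockStart len t ≤ l') (h2' : (l' : ℕ) ≤ blockStart len (t + 1)) : y l = y l' := by
  have H : ∀ d (hd : blockStart len t + d < n), blockStart len t + d ≤ blockStart len (t + 1) →
      y ⟨blockStart len t + d, hd⟩ = y ⟨blockStart len t, by omega⟩ := by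
    intro d
    induction d with
    | zero => intro _ _; rfl
    | succ d ih =>
      intro hd hle
      rw [← ih (by omega) (by omega)]
      have := hy ⟨blockStart len t + d, by omega⟩
        ((h.eq_one_iff _).2 ⟨t, ht, Nat.le_add_right _ _, hle⟩)
      rw [diffMat_apply] at this
      exact (sub_eq_zero.1 this).symm
  have e1 := H (l - blockStart len t) (by omega) (by omega)
  have e2 := H (l' - blockStart len t) (by omega) (by omega)
  simp only [Nat.add_sub_cancel' h1, Nat.add_sub_cancel' h1', Fin.eta] at e1 e2
  rw [e1, e2]

lemma card_block (h : IsBlockDecomposition θ len J) (hn : 0 < n) (t : Fin N) :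
    (Finset.univ.filter fun l : Fin n =>
      blockStart len t ≤ l ∧ (l : ℕ) ≤ blockStart len (t + 1)).card = len t + 1 := by
  have h1 := blockStart_mono len (show (t : ℕ) + 1 ≤ N from t.2)
  have h2 := blockStart_succ len t
  rw [h.blockStart_eq] at h1
  have e : (Finset.univ.filter fun l : Fin n =>
      blockStart len t ≤ l ∧ (l : ℕ) ≤ blockStart len (t + 1)) =
      Finset.Icc ⟨blockStart len t, by omega⟩ ⟨blockStart len (t + 1), by omega⟩ := by
    ext l
    simp [Fin.le_def]
  rw [e, Fin.card_Icc]
  simp only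
  omega

/-- A vector in the kernel is constant on the `len t + 1` rows of each block, so the two factors `1
/ √(len t + 1)` reproduce it; the remaining rows see the diagonal entry `1`. -/
lemma blockAveraging_mulVec (h : IsBlockDecomposition θ len J) (hn : 0 < n) {θs : Fin n → ℝ}
    (hθs : ∀ l : Fin n, ∀ t ∈ J, blockStart len t ≤ l → (l : ℕ) ≤ blockStart len (t + 1) →
      θs l = 0)
    (hθs' : ∀ l : Fin n, (∀ t ∈ J, ¬ (blockStart len t ≤ l ∧ (l : ℕ) ≤ blockStart len (t + 1))) →
      θs l = 1)
    {y : EuclideanSpace ℝ (Fin n)} (hy : ∀ i, θ i = 1 → (diffMat n).toEuclideanLin y i = 0) :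
    blockAveraging θs len J *ᵥ (y : Fin n → ℝ) = y := by
  ext l
  rw [blockAveraging, Matrix.add_mulVec, Pi.add_apply, Matrix.mulVec_diagonal,
    ← Matrix.mulVec_mulVec]
  by_cases hl : ∃ t ∈ J, blockStart len t ≤ l ∧ (l : ℕ) ≤ blockStart len (t + 1)
  · obtain ⟨t, ht, h1, h2⟩ := hl
    obtain ⟨j₀, rfl⟩ : ∃ j, J.orderEmbOfFin rfl j = t := by
      have := J.range_orderEmbOfFin rfl
      rwa [← Finset.mem_coe, ← this] at ht
    rw [hθs l _ ht h1 h2, zero_mul, zero_add]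
    set t := J.orderEmbOfFin rfl j₀ with htdef
    have hpos : (0 : ℝ) < (len t : ℝ) + 1 := by positivity
    have hsum : ((gammaMat n len J)ᵀ *ᵥ (y : Fin n → ℝ)) j₀ =
        ((len t : ℝ) + 1) * (1 / √((len t : ℝ) + 1) * y l) := by
      simp only [Matrix.mulVec, dotProduct, Matrix.transpose_apply, gammaMat_apply, ← htdef,
        ite_mul, zero_mul]
      rw [← Finset.sum_filter]
      rw [Finset.sum_congr rfl (g := fun _ => 1 / √((len t : ℝ) + 1) * y l), Finset.sum_const,
        card_block h hn t, nsmul_eq_mul]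
      · push_cast
        rfl
      · intro k hk
        simp only [Finset.mem_filter, Finset.mem_univ, true_and] at hk
        rw [eq_of_mem_block h ht hy hk.1 hk.2 h1 h2]
    rw [Matrix.mulVec, dotProduct, Finset.sum_eq_single j₀]
    · rw [hsum, gammaMat_apply, ← htdef, if_pos ⟨h1, h2⟩]
      have hs := Real.mul_self_sqrt hpos.le
      have hs0 : √((len t : ℝ) + 1) ≠ 0 := (Real.sqrt_pos.2 hpos).ne'
      field_simp
      rw [sq, hs]
    · intro j _ hj
      rw [gammaMat_apply, if_neg, zero_mul]
      rintro ⟨h3, h4⟩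
      exact hj ((J.orderEmbOfFin rfl).injective
        (h.eq_of_mem (J.orderEmbOfFin_mem rfl j) ht h3 h4 h1 h2))
    · simp
  · have hl' : ∀ t ∈ J, ¬ (blockStart len t ≤ l ∧ (l : ℕ) ≤ blockStart len (t + 1)) :=
      fun t ht hc => hl ⟨t, ht, hc⟩
    rw [hθs' l hl', one_mul, Matrix.mulVec, dotProduct, Finset.sum_eq_zero, add_zero]
    intro j _
    rw [gammaMat_apply, if_neg (hl' _ (J.orderEmbOfFin_mem rfl j)), zero_mul]

/-- With `A` the averaging matrix and `R` the projection, `R A = A` as the columns of `A` lie in the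
kernel, and `A R = R` as `A` fixes the kernel. Both are symmetric, so transposing the first gives `A
R = A`. -/
lemma blockAveraging_eq_rowProj (h : IsBlockDecomposition θ len J) (hn : 0 < n)
    {K : Finset (Fin (n - 1))} (hK : ∀ i, i ∈ K ↔ θ i = 1) {θs : Fin n → ℝ}
    (hθs : ∀ l : Fin n, ∀ t ∈ J, blockStart len t ≤ l → (l : ℕ) ≤ blockStart len (t + 1) →
      θs l = 0)
    (hθs' : ∀ l : Fin n, (∀ t ∈ J, ¬ (blockStart len t ≤ l ∧ (l : ℕ) ≤ blockStart len (t + 1))) →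
      θs l = 1) :
    blockAveraging θs len J = rowProj K := by
  have h1 := rowProj_mul_of_diffRows_mul_eq_zero K _ (diffRows_mul_blockAveraging h hK hθs)
  have h2 : blockAveraging θs len J * rowProj K = rowProj K := by
    apply Matrix.toEuclideanLin.injective
    ext1 e
    rw [Matrix.toLpLin_mul_same, LinearMap.comp_apply, Matrix.toLpLin_apply,
      blockAveraging_mulVec h hn hθs hθs' fun i hi => diffMat_rowProj e i ((hK i).2 hi)]
  have h3 := congrArg Matrix.transpose h1
  rw [Matrix.transpose_mul, rowProj_transpose, blockAveraging_transpose, h2] at h3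
  exact h3.symm

lemma lambdaMat_eq (σ : Equiv.Perm (Fin n)) (θs : Fin n → ℝ) :
    lambdaMat σ θs len J =
      (σ.permMatrix ℝ)ᵀ * blockAveraging θs len J * σ.permMatrix ℝ := by
  have h : Matrix.diagonal ((σ.permMatrix ℝ)ᵀ *ᵥ θs) =
      (σ.permMatrix ℝ)ᵀ * Matrix.diagonal θs * σ.permMatrix ℝ := by
    apply Matrix.toEuclideanLin.injective
    ext x k
    rw [Matrix.toLpLin_mul_same, Matrix.toLpLin_mul_same, LinearMap.comp_apply,
      LinearMap.comp_apply, permMatrix_transpose_apply, Matrix.toLpLin_apply, Matrix.toLpLin_apply]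
    simp only [Matrix.mulVec_diagonal]
    rw [permMatrix_apply, Equiv.apply_symm_apply, Matrix.transpose_permMatrix,
      Matrix.permMatrix_mulVec]
    rfl
  rw [lambdaMat, blockAveraging, Matrix.mul_add, Matrix.add_mul, h]
  simp only [Matrix.mul_assoc]

lemma activeIndicator_eq_one_iff (z : EuclideanSpace ℝ (Fin n)) (i : Fin (n - 1)) :
    activeIndicator z i = 1 ↔ i ∈ activeSet z := by
  classical
  rw [activeIndicator, Set.indicator_apply]
  split_ifs with h <;> simp [h]

lemma exists_isBlockDecomposition_activeIndicator (z : EuclideanSpace ℝ (Fin n)) :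
    ∃ (N : ℕ) (len : Fin N → ℕ) (J : Finset (Fin N)),
      IsBlockDecomposition (activeIndicator z) len J := by
  classical
  refine exists_isBlockDecomposition _ fun i => ?_
  rw [activeIndicator, Set.indicator_apply]
  split_ifs <;> simp

lemma exists_lambdaMat_mem_jacobianSet (hn : 2 ≤ n) {σ : Equiv.Perm (Fin n)}
    {s : EuclideanSpace ℝ (Fin n)}
    (h : IsBlockDecomposition (activeIndicator (sortedShift σ s)) len J) :
    ∃ θs : Fin n → ℝ, List.ofFn θs = thetaList len J ∧
      lambdaMat σ θs len J ∈ jacobianSet σ s := by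
  classical
  obtain ⟨K, hK, hKe⟩ := exists_mem_indexSets_coe_eq_activeSet (sortedShift σ s)
  set f : ℕ → ℝ := fun l =>
    if ∃ t ∈ J, blockStart len t ≤ l ∧ l ≤ blockStart len (t + 1) then 0 else 1 with hf
  refine ⟨fun l => f l, ?_, K, hK, ?_⟩
  · rw [h.thetaList_eq (by omega), Nat.sub_add_cancel (by omega)]
    refine List.ext_getElem (by simp) fun i h1 h2 => ?_
    rw [List.getElem_ofFn, List.getElem_map, List.getElem_range]
  · rw [lambdaMat_eq, jacobianElement_eq, blockAveraging_eq_rowProj h (by omega) (K := K)]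
    · intro i
      rw [activeIndicator_eq_one_iff, ← hKe]
      rfl
    · intro l t ht h1 h2
      exact if_pos ⟨t, ht, h1, h2⟩
    · intro l hl
      exact if_neg fun ⟨t, ht, hc⟩ => hl t ht hc

end Distinguished

end RankLoss

end

theorem proposition1 (n : ℕ) (hn : 2 ≤ n) (s : EuclideanSpace ℝ (Fin n))
    (σ : Equiv.Perm (Fin n)) (hσ : RankLoss.Sorts σ s) :
    -- (i) the proximal mapping is well defined, and is sorting followed by the projection onto `D`,
    -- which is well defined and computed by the pool-adjacent-violators algorithm
    ((∀ x p, RankLoss.IsProxPoint (RankLoss.rankLoss n) x p ↔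
        p = RankLoss.prox (RankLoss.rankLoss n) x) ∧
      (∀ z p, RankLoss.IsNearestPoint (RankLoss.monoCone n) z p ↔
        p = RankLoss.proj (RankLoss.monoCone n) z) ∧
      RankLoss.prox (RankLoss.rankLoss n) s =
        (σ.permMatrix ℝ)ᵀ.toEuclideanLin
          (RankLoss.proj (RankLoss.monoCone n)
            ((σ.permMatrix ℝ).toEuclideanLin s - RankLoss.rho n)) ∧
      (∀ z, List.ofFn (fun k => RankLoss.proj (RankLoss.monoCone n) z k) =
        RankLoss.pav (List.ofFn fun k => z k))) ∧
    -- (ii) the explicit matrices (the inverses in them exist) are exactly the limits of Jacobians,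
    -- so that their convex hull is the Clarke generalized Jacobian
    ((∀ K : Finset (Fin (n - 1)),
        IsUnit (RankLoss.diffRows K * (RankLoss.diffRows K)ᵀ)) ∧
      RankLoss.bouligand (RankLoss.prox (RankLoss.rankLoss n)) s = RankLoss.jacobianSet σ s ∧
      RankLoss.clarke (RankLoss.prox (RankLoss.rankLoss n)) s =
        convexHull ℝ (RankLoss.jacobianSet σ s)) ∧
    -- (iii) strong semismoothness
    (RankLoss.IsStronglySemismooth (RankLoss.prox (RankLoss.rankLoss n))
        (RankLoss.clarke (RankLoss.prox (RankLoss.rankLoss n))) ∧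
      RankLoss.IsStronglySemismooth (RankLoss.prox (RankLoss.rankLoss n))
        (RankLoss.bouligand (RankLoss.prox (RankLoss.rankLoss n)))) ∧
    -- (iv) the distinguished element
    ((∃ (N : ℕ) (len : Fin N → ℕ) (J : Finset (Fin N)),
        RankLoss.IsBlockDecomposition
          (RankLoss.activeIndicator (RankLoss.sortedShift σ s)) len J) ∧
      ∀ (N : ℕ) (len : Fin N → ℕ) (J : Finset (Fin N)),
        RankLoss.IsBlockDecomposition
          (RankLoss.activeIndicator (RankLoss.sortedShift σ s)) len J →
        ∃ θs : Fin n → ℝ, List.ofFn θs = RankLoss.thetaList len J ∧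
          RankLoss.lambdaMat σ θs len J ∈ RankLoss.jacobianSet σ s ∧
          RankLoss.lambdaMat σ θs len J ∈
            RankLoss.clarke (RankLoss.prox (RankLoss.rankLoss n)) s) := by
  have hF : RankLoss.prox (RankLoss.rankLoss n) =ᶠ[𝓝 s] RankLoss.permProj σ :=
    hσ.eventually_prox_eq hn
  have hB := RankLoss.bouligand_eq_jacobianSet hF
  refine ⟨⟨RankLoss.isProxPoint_rankLoss_iff, RankLoss.isNearestPoint_monoCone_iff, hσ.prox_eq,
    RankLoss.ofFn_proj_monoCone⟩, ⟨RankLoss.isUnit_diffRows_mul_transpose, hB, ?_⟩,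
    ⟨RankLoss.isStronglySemismooth_clarke_prox hn, RankLoss.isStronglySemismooth_bouligand_prox hn⟩,
    RankLoss.exists_isBlockDecomposition_activeIndicator _, fun N len J h => ?_⟩
  · rw [RankLoss.clarke, hB]
  · obtain ⟨θs, hθs, hΛ⟩ := RankLoss.exists_lambdaMat_mem_jacobianSet hn h
    refine ⟨θs, hθs, hΛ, subset_convexHull ℝ _ ?_⟩
    rwa [hB]
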